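/- A prudent walk is a nearest neighbour walk on $\mathbb Z^2$ starting at $(0,0)$ that never takes a step in the direction of an already visited vertex, i.e. no visited vertex lies on the open ray that starts at the current vertex and points in the direction of the step. Its box at a given time is the minimal bounding rectangle of the vertices visited so far. A prudent walk is two-sided if each of its steps ends on the top side or on the right side of the current box. A two-sided prudent polygon is a two-sided prudent walk, not consisting of a single edge, whose last vertex is adjacent to its first one; its perimeter is the number of steps plus one (for the closing edge). Let $pp_2^{(m)}$ be the number of two-sided prudent polygons of half-perimeter $m$ and $PP_2(t)=\sum_{m} pp_2^{(m)}t^m$. Proposition. The generating function $PP_2(t)$ is algebraic of degree $2$ over $\mathbb C(t)$. It has a unique dominant singularity, which is a square root singularity at $t=\rho$; that is, $\rho>0$ is the radius of convergence, $PP_2$ extends analytically to a neighbourhood of every point $\zeta\neq\rho$ with $|\zeta|=\rho$, and $PP_2(t)=g(t)+h(t)\sqrt{1-t/\rho}$ for $|t|<\rho$, $t$ near $\rho$, with $g,h$ analytic at $\rho$ and $h(\rho)\ne0$. Here $\rho$ is the unique real root of $$\frac{1-4t+2t^2+t^4}{1-t}=1-3t-t^2-t^3=0 .$$ With $\theta=\sqrt[3]{26+6\sqrt{33}}$,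 $$\rho=\frac{\theta^2-\theta-8}{3\theta}=0.2955977\ldots .$$ As $m\to\infty$, $$pp_2^{(m)}\sim A\,\rho^{-m}\,m^{-3/2},\qquad A=\frac{\sqrt{(-37+11\sqrt{33})\theta^2+(-152+8\sqrt{33})\theta+32}}{4\sqrt{6\pi}\,\rho}=0.8548166\ldots .$$ -/

import Mathlib

open Filter Topology Asymptotics
open scoped PowerSeries LaurentSeries RatFunc

namespace Prudent

/-- The four unit steps of the square lattice. -/
inductive Step where
  | left | right | up | down
  deriving DecidableEq

instance : Fintype Step where
  elems := {.left, .right, .up, .down}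
  complete s := by cases s <;> simp

/-- The displacement of a unit step. -/
def Step.vec : Step → ℤ × ℤ
  | .left => (-1, 0)
  | .right => (1, 0)
  | .up => (0, 1)
  | .down => (0, -1)

/-- The end vertex of the nearest neighbour walk that starts at the origin and takes the steps of
the list `w` one after the other. The vertices of this walk are `endpoint r` for the prefixes `r`
of `w` (with `r = []` giving the origin). -/
def endpoint (w : List Step) : ℤ × ℤ := (w.map Step.vec).sum

/-- A walk is prudent if it never takes a step towards an already occupied vertex: a step `s` taken
after the partial walk `p` is such that no vertex of `p` lies at a distance `k ≥ 1` from the current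
vertex in the direction of `s`. (In particular, the walk is self-avoiding.) -/
def IsPrudent (w : List Step) : Prop :=
  ∀ (p : List Step) (s : Step) (q : List Step), w = p ++ s :: q →
    ∀ r, r <+: p → ∀ k : ℕ, 1 ≤ k → endpoint r ≠ endpoint p + k • s.vec

/-- The walk `p` ends on the top side of its box, the minimal bounding rectangle of its vertices:
its end vertex has the maximal ordinate among all its vertices. -/
def EndsOnTop (p : List Step) : Prop :=
  ∀ r, r <+: p → (endpoint r).2 ≤ (endpoint p).2

/-- The walk `p` ends on the right side of its box. -/
def EndsOnRight (p : List Step) : Prop :=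
  ∀ r, r <+: p → (endpoint r).1 ≤ (endpoint p).1

/-- A two-sided prudent walk: a prudent walk each of whose steps ends on the top or on the right side
of the current box. -/
def IsTwoSidedWalk (w : List Step) : Prop :=
  IsPrudent w ∧ ∀ p, p <+: w → p ≠ [] → EndsOnTop p ∨ EndsOnRight p

/-- A two-sided prudent polygon: a two-sided prudent walk, other than a single edge, whose last vertex
is adjacent to its first one. -/
def IsTwoSidedPolygon (w : List Step) : Prop :=
  IsTwoSidedWalk w ∧ w.length ≠ 1 ∧ ∃ s : Step, endpoint w = s.vec

/-- The number of edges of the closed polygon, the closing edge included. -/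
def perimeter (w : List Step) : ℕ := w.length + 1

/-- The two-sided prudent polygons of half-perimeter `m`. -/
def twoSidedPolygons (m : ℕ) : Set (List Step) :=
  {w | IsTwoSidedPolygon w ∧ perimeter w = 2 * m}

/-- There are finitely many two-sided prudent polygons of each half-perimeter. -/
theorem finite_twoSidedPolygons (m : ℕ) : (twoSidedPolygons m).Finite := by
  refine (List.finite_length_eq Step (2 * m - 1)).subset ?_
  rintro w ⟨-, hw⟩
  simp only [perimeter] at hw
  change w.length = 2 * m - 1
  omega

/-- The number of two-sided prudent polygons of half-perimeter `m`. -/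
noncomputable def pp₂ (m : ℕ) : ℕ := (twoSidedPolygons m).ncard

/-- The half-perimeter generating function of two-sided prudent polygons. -/
noncomputable def PP₂ : ℂ⟦X⟧ := PowerSeries.mk fun m => (pp₂ m : ℂ)

/-- A formal power series is algebraic of degree `d` if it is algebraic over the field `ℂ(t)` of
rational functions (inside the field of formal Laurent series), with minimal polynomial of degree
`d`. -/
def IsAlgebraicOfDegree (F : ℂ⟦X⟧) (d : ℕ) : Prop :=
  IsAlgebraic (RatFunc ℂ) (F : ℂ⸨X⸩) ∧ (minpoly (RatFunc ℂ) (F : ℂ⸨X⸩)).natDegree = d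

/-- The sum of a power series, as a function on its disc of convergence. -/
noncomputable def analyticSum (F : ℂ⟦X⟧) (t : ℂ) : ℂ := ∑' n, F.coeff n * t ^ n

/-- The radius of convergence of a power series. -/
noncomputable def convergenceRadius (F : ℂ⟦X⟧) : ENNReal :=
  (FormalMultilinearSeries.ofScalars ℂ fun n => F.coeff n).radius

/-- The power series `F` has a unique dominant singularity, which lies at `ρ > 0` and is a square root
singularity: `ρ` is the radius of convergence, the sum of `F` extends analytically to a neighbourhood
of each point other than `ρ` of the circle of convergence, and near `ρ` it is of the form
`g t + h t * √(1 - t / ρ)` with `g` and `h` analytic at `ρ` and `h ρ ≠ 0`. (For `‖t‖ < ρ` the number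
`1 - t / ρ` has positive real part, and the root is the principal one.) -/
structure HasDominantSqrtSingularity (F : ℂ⟦X⟧) (ρ : ℝ) : Prop where
  pos : 0 < ρ
  radius_eq : convergenceRadius F = ENNReal.ofReal ρ
  regular_of_ne : ∀ ζ : ℂ, ‖ζ‖ = ρ → ζ ≠ ρ → ∃ g : ℂ → ℂ, AnalyticAt ℂ g ζ ∧
    ∀ᶠ t in 𝓝[Metric.ball 0 ρ] ζ, analyticSum F t = g t
  sqrt_at : ∃ g h : ℂ → ℂ, AnalyticAt ℂ g ρ ∧ AnalyticAt ℂ h ρ ∧ h ρ ≠ 0 ∧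
    ∀ᶠ t in 𝓝[Metric.ball 0 ρ] (ρ : ℂ),
      analyticSum F t = g t + h t * (1 - t / ρ) ^ (1 / 2 : ℂ)

/-- The real number `θ = ∛(26 + 6 √33)`. -/
noncomputable def theta : ℝ := (26 + 6 * √33) ^ (1 / 3 : ℝ)

end Prudent

namespace Prudent

/-! ### Vertices of a walk -/

/-! Geometry. Reflection in the diagonal exchanges the polygons ending at $(1,0)$ and at $(0,1)$,
and no other endpoint occurs (`IsTwoSidedPolygon.endpoint_cases`). A polygon ending at $(1,0)$ stays
in $x\le 1$. In such a strip prudence and two-sidedness are rigid: a down step cannot end on top, so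
it must run along the right side, where it may not face an earlier vertex. Hence the polygon is
either down–right–up, or an "excursion" (no down steps, no reversals, $x\le 0$, back to column $0$)
closed by one right step and a straight descent (`IsTwoSidedWalk.eq_downUp_or_closeDown`). This
gives `pp₂_succ`.

Counting. Let $E$ be the series of excursions, marked by left and up steps. Splitting a walk from
depth $j+1$ at its first arrival in the boundary column multiplies the series for depth $j$ by a
fixed factor, which closes the first-step recursion into $t^2E^2-(1-t)^2E+(1-t)=0$
(`excursionSeries_quadratic`). With $D=(1-t)^2-2t^2E$ one gets $D^2=(1-t)(1-3t-t^2-t^3)$, and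
$t\,PP_2$ is a rational series minus $D$ (`X_mul_PP₂`).

Analysis. As $D(0)=1$, comparing squares gives $D=K\cdot\sqrt{1-t/\rho}$ with $K$ analytic in the
unit disc (`exists_discriminantRoot_eq_mul`). This one factorization yields the singular structure.
It also yields the asymptotics, without contour integrals: the coefficients of $\sqrt{1-t/\rho}$ are
Catalan numbers up to scaling, and convolution with the rapidly decreasing $K_i\rho^i$ only
multiplies their asymptotics by $K(\rho)$ (`tendsto_cauchyProduct`). Degree exactly $2$ holds
because $1$ is a root of odd order of the discriminant. -/

theorem endpoint_nil : endpoint [] = 0 := rfl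

theorem endpoint_append (u v : List Step) : endpoint (u ++ v) = endpoint u + endpoint v := by
  simp [endpoint]

theorem endpoint_cons (s : Step) (w : List Step) : endpoint (s :: w) = s.vec + endpoint w := by
  simp [endpoint]

theorem endpoint_concat (w : List Step) (s : Step) :
    endpoint (w ++ [s]) = endpoint w + s.vec := by
  simp [endpoint]

theorem endpoint_replicate (k : ℕ) (s : Step) : endpoint (List.replicate k s) = k • s.vec := by
  simp [endpoint]

/-- The vertices of a walk. -/
def visited (w : List Step) : Set (ℤ × ℤ) := {v | ∃ r, r <+: w ∧ endpoint r = v}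

theorem visited_nil : visited [] = {0} := by
  ext v
  simp [visited, endpoint_nil, eq_comm]

theorem visited_concat (w : List Step) (s : Step) :
    visited (w ++ [s]) = insert (endpoint w + s.vec) (visited w) := by
  ext v
  simp only [visited, List.prefix_concat_iff, Set.mem_ofPred_eq, Set.mem_insert_iff]
  constructor
  · rintro ⟨r, rfl | h, rfl⟩
    · exact Or.inl (endpoint_concat w s)
    · exact Or.inr ⟨r, h, rfl⟩
  · rintro (rfl | ⟨r, h, rfl⟩)
    · exact ⟨_, Or.inl rfl, endpoint_concat w s⟩
    · exact ⟨r, Or.inr h, rfl⟩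

theorem endpoint_mem_visited (w : List Step) : endpoint w ∈ visited w :=
  ⟨w, List.prefix_rfl, rfl⟩

theorem zero_mem_visited (w : List Step) : (0 : ℤ × ℤ) ∈ visited w :=
  ⟨[], List.nil_prefix, rfl⟩

theorem visited_mono {u w : List Step} (h : u <+: w) : visited u ⊆ visited w := by
  rintro v ⟨r, hr, rfl⟩
  exact ⟨r, hr.trans h, rfl⟩

theorem forall_visited {w : List Step} {P : ℤ × ℤ → Prop} :
    (∀ v ∈ visited w, P v) ↔ ∀ r, r <+: w → P (endpoint r) := by
  constructor
  · exact fun h r hr => h _ ⟨r, hr, rfl⟩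
  · rintro h _ ⟨r, hr, rfl⟩
    exact h r hr

theorem endsOnTop_iff {w : List Step} :
    EndsOnTop w ↔ ∀ v ∈ visited w, v.2 ≤ (endpoint w).2 :=
  (forall_visited (P := fun v => v.2 ≤ (endpoint w).2)).symm

theorem endsOnRight_iff {w : List Step} :
    EndsOnRight w ↔ ∀ v ∈ visited w, v.1 ≤ (endpoint w).1 :=
  (forall_visited (P := fun v => v.1 ≤ (endpoint w).1)).symm

/-! ### Extending a walk by one step -/

theorem isPrudent_nil : IsPrudent [] := by
  intro p s q h
  simp at h

theorem isPrudent_concat {w : List Step} {s : Step} :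
    IsPrudent (w ++ [s]) ↔ IsPrudent w ∧
      ∀ v ∈ visited w, ∀ k : ℕ, 1 ≤ k → v ≠ endpoint w + k • s.vec := by
  constructor
  · intro h
    refine ⟨fun p a q hw => h p a (q ++ [s]) (by simp [hw]), ?_⟩
    rintro _ ⟨r, hr, rfl⟩
    exact h w s [] rfl r hr
  · rintro ⟨h, hb⟩ p a q hw r hr
    rcases List.eq_nil_or_concat q with rfl | ⟨q, b, rfl⟩
    · obtain ⟨rfl, h'⟩ := List.append_inj' hw rfl
      obtain rfl : s = a := by simpa using h'
      exact hb _ ⟨r, hr, rfl⟩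
    · have hw' : w ++ [s] = (p ++ a :: q) ++ [b] := by simpa using hw
      exact h p a q (List.append_inj' hw' rfl).1 r hr

theorem isTwoSidedWalk_nil : IsTwoSidedWalk [] :=
  ⟨isPrudent_nil, fun _ hp hne => absurd (List.prefix_nil.1 hp) hne⟩

theorem isTwoSidedWalk_concat {w : List Step} {s : Step} :
    IsTwoSidedWalk (w ++ [s]) ↔ IsTwoSidedWalk w ∧
      (∀ v ∈ visited w, ∀ k : ℕ, 1 ≤ k → v ≠ endpoint w + k • s.vec) ∧
      ((∀ v ∈ visited w, v.2 ≤ (endpoint w + s.vec).2) ∨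
        ∀ v ∈ visited w, v.1 ≤ (endpoint w + s.vec).1) := by
  have key : (EndsOnTop (w ++ [s]) ∨ EndsOnRight (w ++ [s])) ↔
      ((∀ v ∈ visited w, v.2 ≤ (endpoint w + s.vec).2) ∨
        ∀ v ∈ visited w, v.1 ≤ (endpoint w + s.vec).1) := by
    simp [endsOnTop_iff, endsOnRight_iff, visited_concat, endpoint_concat]
  rw [← key, IsTwoSidedWalk, IsTwoSidedWalk, isPrudent_concat]
  constructor
  · rintro ⟨⟨h1, h2⟩, h3⟩
    exact ⟨⟨h1, fun p hp => h3 p (hp.trans (List.prefix_append _ _))⟩, h2,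
      h3 _ List.prefix_rfl (by simp)⟩
  · rintro ⟨⟨h1, h3⟩, h2, h4⟩
    refine ⟨⟨h1, h2⟩, fun p hp hne => ?_⟩
    rcases List.prefix_concat_iff.1 hp with rfl | hp
    · exact h4
    · exact h3 p hp hne

theorem IsTwoSidedWalk.of_prefix {u w : List Step} (hw : IsTwoSidedWalk w) (h : u <+: w) :
    IsTwoSidedWalk u := by
  obtain ⟨v, rfl⟩ := h
  induction v using List.reverseRecOn with
  | nil => simpa using hw
  | append_singleton v s ih =>
    rw [← List.append_assoc] at hw
    exact ih (isTwoSidedWalk_concat.1 hw).1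

theorem IsTwoSidedWalk.endpoint_notMem {w : List Step} {s : Step}
    (h : IsTwoSidedWalk (w ++ [s])) : endpoint w + s.vec ∉ visited w := fun hv =>
  (isTwoSidedWalk_concat.1 h).2.1 _ hv 1 le_rfl (by simp)

/-- A prudent walk is self-avoiding. -/
theorem IsTwoSidedWalk.eq_nil_of_endpoint_eq {u v : List Step} (h : IsTwoSidedWalk (u ++ v))
    (he : endpoint (u ++ v) = endpoint u) : v = [] := by
  rcases List.eq_nil_or_concat v with rfl | ⟨v, s, rfl⟩
  · rfl
  · rw [List.concat_eq_append, ← List.append_assoc] at h he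
    rw [endpoint_concat] at he
    exact absurd (he ▸ visited_mono (List.prefix_append u v) (endpoint_mem_visited u))
      h.endpoint_notMem

/-- In a prudent walk no step is followed by the opposite one. -/
theorem IsTwoSidedWalk.vec_add_vec_ne_zero {w : List Step} {a b : Step}
    (h : IsTwoSidedWalk (w ++ [a] ++ [b])) : a.vec + b.vec ≠ 0 := by
  intro hab
  refine h.endpoint_notMem (visited_mono (List.prefix_append w [a]) ?_)
  rw [endpoint_concat, add_assoc, hab, add_zero]
  exact endpoint_mem_visited w

/-! ### Reflection in the diagonal -/

/-- The reflection of a step in the diagonal. -/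
def Step.swap : Step → Step
  | .left => .down
  | .right => .up
  | .up => .right
  | .down => .left

theorem Step.swap_swap (s : Step) : s.swap.swap = s := by cases s <;> rfl

theorem Step.vec_swap (s : Step) : s.swap.vec = s.vec.swap := by cases s <;> rfl

theorem map_swap_map_swap (w : List Step) : (w.map Step.swap).map Step.swap = w := by
  simp [Function.comp_def, Step.swap_swap]

theorem endpoint_map_swap (w : List Step) : endpoint (w.map Step.swap) = (endpoint w).swap := by
  induction w with
  | nil => rfl
  | cons s w ih => rw [List.map_cons, endpoint_cons, endpoint_cons, ih, Step.vec_swap]; rfl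

theorem visited_map_swap (w : List Step) :
    visited (w.map Step.swap) = Prod.swap '' visited w := by
  induction w using List.reverseRecOn with
  | nil => simp [visited_nil]
  | append_singleton w s ih =>
    rw [List.map_append, List.map_singleton, visited_concat, visited_concat, ih, Set.image_insert_eq,
      endpoint_map_swap, Step.vec_swap]
    rfl

theorem IsTwoSidedWalk.map_swap {w : List Step} (h : IsTwoSidedWalk w) :
    IsTwoSidedWalk (w.map Step.swap) := by
  induction w using List.reverseRecOn with
  | nil => exact h
  | append_singleton w s ih =>
    obtain ⟨h1, h2, h3⟩ := isTwoSidedWalk_concat.1 h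
    rw [List.map_append, List.map_singleton, isTwoSidedWalk_concat, visited_map_swap,
      endpoint_map_swap, Step.vec_swap]
    refine ⟨ih h1, ?_, ?_⟩
    · rintro _ ⟨v, hv, rfl⟩ k hk heq
      refine h2 v hv k hk (Prod.swap_injective ?_)
      rw [heq]
      ext <;> simp
    · rw [or_comm]
      refine h3.imp ?_ ?_
      · rintro h _ ⟨v, hv, rfl⟩
        exact h v hv
      · rintro h _ ⟨v, hv, rfl⟩
        exact h v hv

theorem EndsOnRight.map_swap {w : List Step} (h : EndsOnRight w) :
    EndsOnTop (w.map Step.swap) := by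
  rw [endsOnTop_iff, visited_map_swap, endpoint_map_swap]
  rintro _ ⟨v, hv, rfl⟩
  exact endsOnRight_iff.1 h v hv

theorem EndsOnTop.map_swap {w : List Step} (h : EndsOnTop w) :
    EndsOnRight (w.map Step.swap) := by
  rw [endsOnRight_iff, visited_map_swap, endpoint_map_swap]
  rintro _ ⟨v, hv, rfl⟩
  exact endsOnTop_iff.1 h v hv

end Prudent

namespace Prudent

/-! ### Walks without down steps in a left half-plane -/

/-- A walk without down steps and without reversals, also when it is preceded by the step `a`, that
stays in the half-plane of abscissae at most `j`. -/
def IsUpward (a : Step) (j : ℤ) (w : List Step) : Prop :=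
  Step.down ∉ w ∧ List.IsChain (fun b c : Step => b.vec + c.vec ≠ 0) (a :: w) ∧
    ∀ v ∈ visited w, v.1 ≤ j

theorem isUpward_nil {a : Step} {j : ℤ} (hj : 0 ≤ j) : IsUpward a j [] := by
  simpa [IsUpward, visited_nil] using hj

/-- The default `a` in `getLastD` makes the virtual preceding step play the role of the last step
when `w` is empty. -/
theorem isUpward_concat {a : Step} {j : ℤ} {w : List Step} {s : Step} :
    IsUpward a j (w ++ [s]) ↔ IsUpward a j w ∧ s ≠ .down ∧
      (w.getLastD a).vec + s.vec ≠ 0 ∧ (endpoint w + s.vec).1 ≤ j := by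
  have hc : List.IsChain (fun b c : Step => b.vec + c.vec ≠ 0) (a :: (w ++ [s])) ↔
      List.IsChain (fun b c : Step => b.vec + c.vec ≠ 0) (a :: w) ∧
        (w.getLastD a).vec + s.vec ≠ 0 := by
    rw [← List.cons_append, List.isChain_append]
    simp [List.getLast?_cons]
  simp only [IsUpward, hc, visited_concat, Set.forall_mem_insert, List.mem_append,
    List.mem_singleton, not_or]
  tauto

theorem endpoint_snd_eq_count {w : List Step} (h : Step.down ∉ w) :
    (endpoint w).2 = w.count .up := by
  induction w with
  | nil => rfl
  | cons s w ih =>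
    rw [List.mem_cons, not_or] at h
    rw [endpoint_cons, Prod.snd_add, ih h.2]
    cases s <;> simp_all [Step.vec, add_comm]

theorem IsUpward.snd_le {a : Step} {j : ℤ} {w : List Step} (h : IsUpward a j w) :
    ∀ v ∈ visited w, 0 ≤ v.2 ∧ v.2 ≤ (endpoint w).2 := by
  induction w using List.reverseRecOn with
  | nil => simp [visited_nil, endpoint_nil]
  | append_singleton w s ih =>
    obtain ⟨h1, h2, -, -⟩ := isUpward_concat.1 h
    have hs : 0 ≤ s.vec.2 := by cases s <;> simp_all [Step.vec]
    have h0 := ih h1 _ (endpoint_mem_visited w)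
    rw [visited_concat, Set.forall_mem_insert, endpoint_concat, Prod.snd_add]
    refine ⟨by lia, fun v hv => ?_⟩
    have := ih h1 v hv
    lia

/-- Without down steps and reversals each row is traversed by a single horizontal run in one
direction, so the current vertex is extreme in its row on the side towards which the walk may
continue. -/
theorem IsUpward.fst_le_of_snd_eq {a : Step} {j : ℤ} {w : List Step} (h : IsUpward a j w) :
    ∀ v ∈ visited w, v.2 = (endpoint w).2 →
      (w.getLastD a ≠ .left → v.1 ≤ (endpoint w).1) ∧
      (w.getLastD a ≠ .right → (endpoint w).1 ≤ v.1) := by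
  induction w using List.reverseRecOn with
  | nil => simp [visited_nil, endpoint_nil]
  | append_singleton w s ih =>
    obtain ⟨h1, h2, h3, -⟩ := isUpward_concat.1 h
    rw [visited_concat, Set.forall_mem_insert, endpoint_concat, List.getLastD_concat]
    refine ⟨by simp, fun v hv hrow => ?_⟩
    have hle := h1.snd_le v hv
    have ih' := ih h1 v hv
    generalize w.getLastD a = b at *
    cases s <;> cases b <;> simp_all [Step.vec] <;> lia

/-- Such a walk is always on top of its box, so an up step sees nothing, and a horizontal step
prolongs a run whose earlier vertices all lie behind it. -/
theorem IsUpward.isTwoSidedWalk {w : List Step} (h : IsUpward .up 0 w) : IsTwoSidedWalk w := by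
  induction w using List.reverseRecOn with
  | nil => exact isTwoSidedWalk_nil
  | append_singleton w s ih =>
    obtain ⟨h1, h2, h3, -⟩ := isUpward_concat.1 h
    refine isTwoSidedWalk_concat.2 ⟨ih h1, ?_, Or.inl fun v hv => ?_⟩
    · rintro v hv k hk rfl
      have hle := h1.snd_le _ hv
      have hrow := h1.fst_le_of_snd_eq _ hv
      generalize w.getLastD Step.up = b at *
      cases s <;> cases b <;> simp_all [Step.vec]
    · have hle := h1.snd_le v hv
      have hs : 0 ≤ s.vec.2 := by cases s <;> simp_all [Step.vec]
      rw [Prod.snd_add]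
      lia

/-! ### Two-sided walks in a left half-plane -/

/-- The default `.up` only forbids a first step down, which is excluded by `hs`. -/
theorem IsTwoSidedWalk.getLastD_vec_ne_zero {w : List Step} {s : Step} (hs : s ≠ .down)
    (h : IsTwoSidedWalk (w ++ [s])) : (w.getLastD .up).vec + s.vec ≠ 0 := by
  rcases List.eq_nil_or_concat w with rfl | ⟨w, b, rfl⟩
  · cases s <;> simp_all [Step.vec]
  · rw [List.concat_eq_append] at h ⊢
    rw [List.getLastD_concat]
    exact h.vec_add_vec_ne_zero

theorem replicate_concat {k : ℕ} (s : Step) :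
    List.replicate k s ++ [s] = List.replicate (k + 1) s :=
  List.replicate_succ'.symm

/-- A down step never ends on top, hence it ends on the right side, which is column $0$ because of
the origin. From a positive height it would face the origin, so it can only be a first step or
follow other down steps. After a descent, a left step would end neither on top nor on the right. -/
theorem IsTwoSidedWalk.eq_replicate_or_isUpward {w : List Step} (h : IsTwoSidedWalk w)
    (hx : ∀ v ∈ visited w, v.1 ≤ 0) :
    (∃ k, 1 ≤ k ∧ w = List.replicate k .down) ∨ IsUpward .up 0 w := by
  induction w using List.reverseRecOn with
  | nil => exact Or.inr (isUpward_nil le_rfl)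
  | append_singleton w s ih =>
    rw [visited_concat, Set.forall_mem_insert] at hx
    obtain ⟨h1, h2, h3⟩ := isTwoSidedWalk_concat.1 h
    rcases ih h1 hx.2 with ⟨k, hk, rfl⟩ | hw
    · have h0 := zero_mem_visited (List.replicate k Step.down)
      have hr : s ≠ .up := by
        rintro rfl
        obtain ⟨k, rfl⟩ := Nat.exists_eq_add_of_le' hk
        rw [← replicate_concat] at h
        exact h.vec_add_vec_ne_zero (by simp [Step.vec])
      cases s
      · exfalso
        rcases h3 with h3 | h3 <;> have h3 := h3 _ h0 <;>
          simp [endpoint_replicate, Step.vec] at h3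
        lia
      · simp [endpoint_replicate, Step.vec] at hx
      · exact absurd rfl hr
      · exact Or.inl ⟨k + 1, by lia, replicate_concat _⟩
    · by_cases hs : s = .down
      · subst hs
        have h0 := zero_mem_visited w
        have he := endpoint_mem_visited w
        have hle := hw.snd_le _ he
        have hx0 : (endpoint w).1 = 0 := by
          have := hx.2 _ he
          rcases h3 with h3 | h3
          · have := h3 _ he
            simp [Step.vec] at this
          · have := h3 _ h0
            simp [Step.vec] at this
            lia
        have hy0 : (endpoint w).2 = 0 := by
          by_contra hne
          refine h2 _ h0 (endpoint w).2.toNat (by lia) ?_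
          ext <;> simp [Step.vec, hx0, hle.1]
        have : w = [] := by
          refine IsTwoSidedWalk.eq_nil_of_endpoint_eq (u := []) h1 ?_
          ext <;> simp [endpoint_nil, hx0, hy0]
        subst this
        exact Or.inl ⟨1, le_rfl, rfl⟩
      · exact Or.inr (isUpward_concat.2 ⟨hw, hs, h.getLastD_vec_ne_zero hs, hx.1⟩)

theorem exists_first_right (w : List Step) :
    (∀ v ∈ visited w, v.1 ≤ 0) ∨ ∃ p q, w = p ++ .right :: q ∧
      (∀ v ∈ visited p, v.1 ≤ 0) ∧ (endpoint p).1 = 0 := by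
  induction w using List.reverseRecOn with
  | nil => simp [visited_nil]
  | append_singleton w s ih =>
    rcases ih with ih | ⟨p, q, rfl, hp, h0⟩
    · by_cases hle : (endpoint w + s.vec).1 ≤ 0
      · left
        rw [visited_concat, Set.forall_mem_insert]
        exact ⟨hle, ih⟩
      · right
        have := ih _ (endpoint_mem_visited w)
        rw [Prod.fst_add] at hle
        cases s <;> simp [Step.vec] at hle <;> try lia
        exact ⟨w, [], rfl, ih, by lia⟩
    · exact Or.inr ⟨p, q ++ [s], by simp, hp, h0⟩

/-! ### Two-sided walks that cross to the column of abscissa one -/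

/-- The argument for the half-plane $x\le 0$ is repeated with the first vertex of column $1$ in
place of the origin: a later down step would face that vertex. Only a descent begun right after the
crossing escapes, and it must then go straight down. -/
theorem IsTwoSidedWalk.isUpward_right_cases {p q : List Step}
    (h : IsTwoSidedWalk (p ++ .right :: q)) (hp : IsUpward .up 0 p) (hp0 : (endpoint p).1 = 0)
    (hx : ∀ v ∈ visited (p ++ .right :: q), v.1 ≤ 1) :
    (∃ i, q = List.replicate i .down) ∨
      q ≠ [] ∧ (∀ v ∈ visited (p ++ .right :: q), v.2 ≤ (endpoint (p ++ .right :: q)).2) := by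
  induction q using List.reverseRecOn with
  | nil => exact Or.inl ⟨0, rfl⟩
  | append_singleton q s ih =>
    have hassoc : p ++ Step.right :: (q ++ [s]) = (p ++ Step.right :: q) ++ [s] := by simp
    rw [hassoc] at h hx ⊢
    rw [visited_concat, Set.forall_mem_insert] at hx
    obtain ⟨h1, h2, h3⟩ := isTwoSidedWalk_concat.1 h
    have hpr : p ++ [Step.right] <+: p ++ Step.right :: q := ⟨q, by simp⟩
    have hm : ((1, (endpoint p).2) : ℤ × ℤ) ∈ visited (p ++ .right :: q) := by
      refine visited_mono hpr ?_
      convert endpoint_mem_visited (p ++ [Step.right]) using 1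
      rw [endpoint_concat]
      ext <;> simp [Step.vec, hp0]
    have he := endpoint_mem_visited (p ++ .right :: q)
    rcases ih h1 hx.2 with ⟨i, rfl⟩ | ⟨hq, ht⟩
    · have hend : endpoint (p ++ Step.right :: List.replicate i .down) = (1, (endpoint p).2 - i) := by
        rw [endpoint_append, endpoint_cons, endpoint_replicate]
        ext <;> simp [Step.vec, hp0, sub_eq_add_neg]
      rw [hend] at hx h3
      rcases Nat.eq_zero_or_pos i with rfl | hi
      · cases s
        · exact absurd (by simp [Step.vec]) (h.vec_add_vec_ne_zero (b := .left))
        · simp [Step.vec] at hx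
        · right
          refine ⟨by simp, ?_⟩
          rw [visited_concat, Set.forall_mem_insert, endpoint_concat,
            show p ++ Step.right :: List.replicate 0 Step.down = p ++ [.right] from rfl,
            visited_concat, Set.forall_mem_insert, endpoint_concat]
          refine ⟨le_rfl, by simp [Step.vec], fun v hv => ?_⟩
          have := hp.snd_le v hv
          simp [Step.vec]
          lia
        · exact Or.inl ⟨1, rfl⟩
      · cases s
        · rcases h3 with h3 | h3 <;> have h3 := h3 _ hm <;> simp [Step.vec] at h3
          lia
        · simp [Step.vec] at hx
        · obtain ⟨i, rfl⟩ := Nat.exists_eq_add_of_le' hi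
          rw [← replicate_concat, ← List.cons_append, ← List.append_assoc] at h
          exact absurd (by simp [Step.vec]) h.vec_add_vec_ne_zero
        · exact Or.inl ⟨i + 1, replicate_concat _⟩
    · by_cases hs : s = .down
      · exfalso
        subst hs
        have hx1 : (endpoint (p ++ .right :: q)).1 = 1 := by
          have := hx.2 _ he
          rcases h3 with h3 | h3
          · have := h3 _ he
            simp [Step.vec] at this
          · have := h3 _ hm
            simp [Step.vec] at this
            lia
        have hy := ht _ hm
        by_cases heq : (endpoint (p ++ .right :: q)).2 = (endpoint p).2
        · refine hq (IsTwoSidedWalk.eq_nil_of_endpoint_eq (u := p ++ [.right]) (by simpa using h1) ?_)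
          rw [List.append_assoc, List.singleton_append, endpoint_concat]
          ext
          · simp [hx1, hp0, Step.vec]
          · simp [heq, Step.vec]
        · simp only at hy
          refine h2 _ hm ((endpoint (p ++ .right :: q)).2 - (endpoint p).2).toNat (by lia) ?_
          ext
          · simp [Step.vec, hx1]
          · simp [Step.vec, hy]
      · right
        refine ⟨by simp, ?_⟩
        have hs0 : 0 ≤ s.vec.2 := by
          clear * - hs
          cases s <;> simp_all [Step.vec]
        rw [visited_concat, Set.forall_mem_insert, endpoint_concat, Prod.snd_add]
        refine ⟨le_rfl, fun v hv => ?_⟩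
        have := ht v hv
        lia

/-- While the walk climbs column $1$ below height $0$, the neighbouring vertices of column $0$ are
occupied, so it cannot turn left before having climbed `k` steps. -/
theorem IsTwoSidedWalk.down_right_cases {k : ℕ} {q : List Step} (hk : 1 ≤ k)
    (h : IsTwoSidedWalk (List.replicate k .down ++ .right :: q))
    (hx : ∀ v ∈ visited (List.replicate k .down ++ .right :: q), v.1 ≤ 1) :
    (∃ i, q = List.replicate i .down) ∨ (∃ j, j ≤ k ∧ q = List.replicate j .up) ∨
      ∃ r, r ≠ [] ∧ q = List.replicate k .up ++ r := by
  induction q using List.reverseRecOn with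
  | nil => exact Or.inl ⟨0, rfl⟩
  | append_singleton q s ih =>
    have hassoc : List.replicate k .down ++ Step.right :: (q ++ [s]) =
      (List.replicate k .down ++ Step.right :: q) ++ [s] := by simp
    rw [hassoc] at h hx
    rw [visited_concat, Set.forall_mem_insert] at hx
    obtain ⟨h1, h2, h3⟩ := isTwoSidedWalk_concat.1 h
    have hend (b : Step) (i : ℕ) : endpoint (List.replicate k .down ++ .right :: List.replicate i b) =
        (1, -(k : ℤ)) + i • b.vec := by
      rw [endpoint_append, endpoint_cons, endpoint_replicate, endpoint_replicate]
      ext <;> simp [Step.vec]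
    have hm : ((1, -k) : ℤ × ℤ) ∈ visited (List.replicate k .down ++ .right :: q) := by
      refine visited_mono (u := List.replicate k .down ++ [.right]) ⟨q, by simp⟩ ?_
      convert endpoint_mem_visited (List.replicate k Step.down ++ [Step.right]) using 1
      simpa using (hend .up 0).symm
    have hd (i : ℕ) (hi : i ≤ k) :
        ((0, -i) : ℤ × ℤ) ∈ visited (List.replicate k .down ++ .right :: q) := by
      refine visited_mono (u := List.replicate i .down) ?_ ?_
      · refine List.IsPrefix.trans ⟨List.replicate (k - i) .down, ?_⟩ (List.prefix_append _ _)
        rw [← List.replicate_add]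
        congr 1
        lia
      · convert endpoint_mem_visited (List.replicate i Step.down) using 1
        rw [endpoint_replicate]
        ext <;> simp [Step.vec]
    have hnot : ∀ b : Step, ∀ i : ℕ, q = List.replicate (i + 1) b → b.vec + s.vec ≠ 0 := by
      rintro b i rfl
      rw [← replicate_concat, ← List.cons_append, ← List.append_assoc] at h
      exact h.vec_add_vec_ne_zero
    have hup (j : ℕ) (hj : j ≤ k) (hq : q = List.replicate j .up) :
        (∃ i, q ++ [s] = List.replicate i .down) ∨ (∃ j, j ≤ k ∧ q ++ [s] = List.replicate j .up) ∨
          ∃ r, r ≠ [] ∧ q ++ [s] = List.replicate k .up ++ r := by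
      rcases hj.eq_or_lt with rfl | hj
      · exact Or.inr (Or.inr ⟨[s], by simp, by rw [hq]⟩)
      · cases s
        · have := h.endpoint_notMem
          refine absurd (hd (k - j) (by lia)) ?_
          convert this using 2
          rw [hq, hend]
          ext
          · simp [Step.vec]
          · simp [Step.vec]
            lia
        · rw [hq, hend] at hx
          simp [Step.vec] at hx
        · exact Or.inr (Or.inl ⟨j + 1, hj, by rw [hq, replicate_concat]⟩)
        · rcases j with _ | j
          · exact Or.inl ⟨1, by rw [hq]; rfl⟩
          · exact absurd (by simp [Step.vec]) (hnot _ _ hq)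
    rcases ih h1 hx.2 with ⟨i, rfl⟩ | ⟨j, hj, hq⟩ | ⟨r, hr, hq⟩
    · rcases i with _ | i
      · exact hup 0 (by lia) rfl
      · rw [hend] at hx h3
        cases s
        · exfalso
          rcases h3 with h3 | h3
          · have h3 := h3 _ (zero_mem_visited _)
            simp [Step.vec] at h3
            lia
          · have h3 := h3 _ hm
            simp [Step.vec] at h3
        · simp [Step.vec] at hx
        · exact absurd (by simp [Step.vec]) (hnot _ _ rfl)
        · exact Or.inl ⟨i + 2, replicate_concat _⟩
    · exact hup j hj hq
    · exact Or.inr (Or.inr ⟨r ++ [s], by simp, by rw [hq, List.append_assoc]⟩)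

end Prudent

namespace Prudent

/-! ### Classification of the two-sided polygons -/

/-- If the end is not $(1,0)$, the right side of the box is column $0$ and the half-plane
classification applies. A descent would have to be the excluded single edge, and an upward walk is
on top. -/
theorem IsTwoSidedWalk.endpoint_of_endsOnRight {w : List Step} (h : IsTwoSidedWalk w)
    (hr : EndsOnRight w) (hl : w.length ≠ 1) {s : Step} (hs : endpoint w = s.vec) :
    endpoint w = (1, 0) ∨ endpoint w = (0, 1) ∧ EndsOnTop w := by
  rw [endsOnRight_iff, hs] at hr
  have h0 := hr _ (zero_mem_visited w)
  by_cases hright : s = .right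
  · left
    rw [hs, hright]
    rfl
  right
  have hx : ∀ v ∈ visited w, v.1 ≤ 0 := by
    intro v hv
    refine (hr v hv).trans ?_
    cases s <;> simp_all [Step.vec]
  rcases h.eq_replicate_or_isUpward hx with ⟨k, hk, rfl⟩ | hw
  · rw [endpoint_replicate] at hs
    have hk1 : k ≠ 1 := by simpa using hl
    cases s <;> simp [Step.vec] at hs <;> lia
  · have hle := hw.snd_le
    rw [endsOnTop_iff]
    refine ⟨?_, fun v hv => (hle v hv).2⟩
    have h1 := hle 0 (zero_mem_visited w)
    rw [hs] at h1 ⊢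
    cases s <;> simp_all [Step.vec]

theorem IsTwoSidedPolygon.endpoint_cases {w : List Step} (h : IsTwoSidedPolygon w) :
    (endpoint w = (1, 0) ∧ EndsOnRight w) ∨ (endpoint w = (0, 1) ∧ EndsOnTop w) := by
  obtain ⟨hw, hl, s, hs⟩ := h
  have hne : w ≠ [] := by
    rintro rfl
    rw [endpoint_nil] at hs
    cases s <;> exact absurd hs (by decide)
  rcases hw.2 w List.prefix_rfl hne with ht | hr
  · have hs' : endpoint (w.map Step.swap) = s.swap.vec := by
      rw [endpoint_map_swap, hs, Step.vec_swap]
    rcases hw.map_swap.endpoint_of_endsOnRight ht.map_swap (by simpa using hl) hs' with h1 | ⟨h1, h2⟩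
    · rw [endpoint_map_swap] at h1
      exact Or.inr ⟨Prod.swap_injective h1, ht⟩
    · rw [endpoint_map_swap] at h1
      exact Or.inl ⟨Prod.swap_injective h1, map_swap_map_swap w ▸ h2.map_swap⟩
  · rcases hw.endpoint_of_endsOnRight hr hl hs with h1 | h1
    · exact Or.inl ⟨h1, hr⟩
    · exact Or.inr h1

theorem IsTwoSidedPolygon.map_swap {w : List Step} (h : IsTwoSidedPolygon w) :
    IsTwoSidedPolygon (w.map Step.swap) := by
  obtain ⟨hw, hl, s, hs⟩ := h
  exact ⟨hw.map_swap, by simpa using hl, s.swap, by rw [endpoint_map_swap, hs, Step.vec_swap]⟩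

/-- The walk that closes an excursion to a polygon: a step to the right, then down steps. -/
def closeDown (p : List Step) : List Step := p ++ .right :: List.replicate (p.count .up) .down

/-- The polygon that goes down, one step to the right, and up. -/
def downUp (k : ℕ) : List Step := List.replicate k .down ++ .right :: List.replicate k .up

/-- The walk is cut at its first step into column $1$. Self-avoidance then settles how it reaches
$(1,0)$: it must stop on arrival there, and in the upward case it cannot be on top at height $0$
unless the part before the crossing is empty. -/
theorem IsTwoSidedWalk.eq_downUp_or_closeDown {w : List Step} (h : IsTwoSidedWalk w)
    (hr : EndsOnRight w) (hl : w.length ≠ 1) (he : endpoint w = (1, 0)) :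
    (∃ k, 1 ≤ k ∧ w = downUp k) ∨
      ∃ p, p ≠ [] ∧ IsUpward .up 0 p ∧ (endpoint p).1 = 0 ∧ w = closeDown p := by
  rw [endsOnRight_iff, he] at hr
  rcases exists_first_right w with hx | ⟨p, q, rfl, hp, hp0⟩
  · have := hx _ (endpoint_mem_visited w)
    simp [he] at this
  · rcases (h.of_prefix (List.prefix_append _ _)).eq_replicate_or_isUpward hp with ⟨k, hk, rfl⟩ | hu
    · left
      refine ⟨k, hk, ?_⟩
      rw [endpoint_append, endpoint_replicate, endpoint_cons] at he
      rcases h.down_right_cases hk hr with ⟨i, rfl⟩ | ⟨j, hj, rfl⟩ | ⟨r, hr', rfl⟩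
      · rw [endpoint_replicate] at he
        simp [Step.vec] at he
        lia
      · rw [endpoint_replicate] at he
        simp [Step.vec] at he
        obtain rfl : j = k := by lia
        rfl
      · refine absurd (IsTwoSidedWalk.eq_nil_of_endpoint_eq (u := downUp k) (v := r) ?_ ?_) hr'
        · simpa [downUp] using h
        · simp only [downUp, endpoint_append, endpoint_cons, endpoint_replicate, ← add_assoc] at he ⊢
          rw [he]
          ext <;> simp [Step.vec]
    · right
      have hne : p ≠ [] := by
        rintro rfl
        have hq := IsTwoSidedWalk.eq_nil_of_endpoint_eq (u := [Step.right]) (v := q) h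
          he
        simp [hq] at hl
      refine ⟨p, hne, hu, hp0, ?_⟩
      have hcount := endpoint_snd_eq_count hu.1
      rcases h.isUpward_right_cases hu hp0 hr with ⟨i, rfl⟩ | ⟨hq, ht⟩
      · rw [endpoint_append, endpoint_cons, endpoint_replicate] at he
        have he2 := congrArg Prod.snd he
        simp [Step.vec, hcount] at he2
        obtain rfl : i = p.count .up := by lia
        rfl
      · exfalso
        have hle := ht _ (visited_mono (List.prefix_append _ _) (endpoint_mem_visited p))
        have h0 := (hu.snd_le _ (endpoint_mem_visited p)).1
        rw [he] at hle
        have : p = [] := by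
          refine IsTwoSidedWalk.eq_nil_of_endpoint_eq (u := []) hu.isTwoSidedWalk ?_
          rw [List.nil_append]
          ext
          · simp [endpoint_nil, hp0]
          · simp [endpoint_nil]
            simp at hle
            lia
        exact hne this

theorem isTwoSidedWalk_replicate_down (k : ℕ) : IsTwoSidedWalk (List.replicate k .down) ∧
    ∀ v ∈ visited (List.replicate k Step.down), v.1 = 0 ∧ -(k : ℤ) ≤ v.2 := by
  induction k with
  | zero => exact ⟨isTwoSidedWalk_nil, by simp [visited_nil]⟩
  | succ k ih =>
    rw [← replicate_concat, isTwoSidedWalk_concat, visited_concat, Set.forall_mem_insert,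
      endpoint_replicate]
    refine ⟨⟨ih.1, ?_, Or.inr fun v hv => ?_⟩, ?_, fun v hv => ?_⟩
    · rintro v hv i hi rfl
      have := ih.2 _ hv
      simp [Step.vec] at this
      lia
    · have := ih.2 v hv
      simp [Step.vec, this.1]
    · simp [Step.vec]
    · have := ih.2 v hv
      push_cast
      lia

/-- The second conjunct is the induction invariant: column $1$ is free above the current vertex. -/
theorem isTwoSidedWalk_downUp (k j : ℕ) :
    IsTwoSidedWalk (List.replicate k .down ++ .right :: List.replicate j .up) ∧
    ∀ v ∈ visited (List.replicate k .down ++ .right :: List.replicate j Step.up),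
      v.1 ≤ 1 ∧ (v.1 = 1 → v.2 ≤ j - k) := by
  obtain ⟨h1, h2⟩ := isTwoSidedWalk_replicate_down k
  have hend : endpoint (List.replicate k Step.down) = (0, -(k : ℤ)) := by
    rw [endpoint_replicate]
    ext <;> simp [Step.vec]
  induction j with
  | zero =>
    rw [List.replicate_zero, isTwoSidedWalk_concat, visited_concat, Set.forall_mem_insert, hend]
    refine ⟨⟨h1, ?_, Or.inr fun v hv => ?_⟩, ?_, fun v hv => ?_⟩
    · rintro v hv i hi rfl
      have := h2 _ hv
      simp [Step.vec] at this
      lia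
    · have := h2 v hv
      simp [Step.vec, this.1]
    · simp [Step.vec]
    · have := h2 v hv
      simp [this.1]
  | succ j ih =>
    have hassoc : List.replicate k .down ++ Step.right :: (List.replicate (j + 1) .up) =
      (List.replicate k .down ++ Step.right :: List.replicate j .up) ++ [.up] := by
      simp [replicate_concat]
    have hend' : endpoint (List.replicate k Step.down ++ .right :: List.replicate j .up) =
        (1, (j - k : ℤ)) := by
      rw [endpoint_append, hend, endpoint_cons, endpoint_replicate]
      ext
      · simp [Step.vec]
      · simp [Step.vec]
        ring
    rw [hassoc, isTwoSidedWalk_concat, visited_concat, Set.forall_mem_insert, hend']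
    refine ⟨⟨ih.1, ?_, Or.inr fun v hv => ?_⟩, ?_, fun v hv => ?_⟩
    · rintro v hv i hi rfl
      have := ih.2 _ hv
      simp [Step.vec] at this
      lia
    · have := ih.2 v hv
      simp [Step.vec, this.1]
    · simp [Step.vec]
    · have := ih.2 v hv
      push_cast
      lia

theorem isTwoSidedWalk_closeDown {p : List Step} (hp : IsUpward .up 0 p)
    (hp0 : (endpoint p).1 = 0) (i : ℕ) :
    IsTwoSidedWalk (p ++ .right :: List.replicate i .down) ∧
    ∀ v ∈ visited (p ++ .right :: List.replicate i .down),
      v.1 ≤ 1 ∧ (v.1 = 1 → (endpoint p).2 - i ≤ v.2) := by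
  induction i with
  | zero =>
    rw [List.replicate_zero, isTwoSidedWalk_concat, visited_concat, Set.forall_mem_insert]
    refine ⟨⟨hp.isTwoSidedWalk, ?_, Or.inr fun v hv => ?_⟩, ?_, fun v hv => ?_⟩
    · rintro v hv i hi rfl
      have := hp.2.2 _ hv
      simp [Step.vec, hp0] at this
      lia
    · have := hp.2.2 v hv
      simp [Step.vec, hp0]
      lia
    · simp [Step.vec, hp0]
    · have := hp.2.2 v hv
      lia
  | succ i ih =>
    have hassoc : p ++ Step.right :: (List.replicate (i + 1) .down) =
      (p ++ Step.right :: List.replicate i .down) ++ [.down] := by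
      simp [replicate_concat]
    have hend : endpoint (p ++ .right :: List.replicate i .down) = (1, (endpoint p).2 - i) := by
      rw [endpoint_append, endpoint_cons, endpoint_replicate]
      ext <;> simp [Step.vec, hp0, sub_eq_add_neg]
    rw [hassoc, isTwoSidedWalk_concat, visited_concat, Set.forall_mem_insert, hend]
    refine ⟨⟨ih.1, ?_, Or.inr fun v hv => ?_⟩, ?_, fun v hv => ?_⟩
    · rintro v hv k hk rfl
      have := ih.2 _ hv
      simp [Step.vec] at this
      lia
    · have := ih.2 v hv
      simp [Step.vec, this.1]
    · simp [Step.vec]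
    · have := ih.2 v hv
      push_cast
      lia

/-- The words without down steps and reversals that lead from the column of abscissa `-j` to the
column of abscissa `0`, do not cross the latter, and have `n` steps to the left or up. -/
def excursions (a : Step) (j : ℤ) (n : ℕ) : Set (List Step) :=
  {w | IsUpward a j w ∧ (endpoint w).1 = j ∧ w.count .up + w.count .left = n}

theorem endpoint_fst_eq_count (w : List Step) :
    (endpoint w).1 = w.count .right - w.count .left := by
  induction w with
  | nil => rfl
  | cons s w ih =>
    rw [endpoint_cons, Prod.fst_add, ih]
    cases s <;> simp [Step.vec] <;> ring

theorem length_eq_count {w : List Step} (h : Step.down ∉ w) :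
    w.length = w.count .up + w.count .left + w.count .right := by
  induction w with
  | nil => rfl
  | cons s w ih =>
    rw [List.mem_cons, not_or] at h
    rw [List.length_cons, ih h.2]
    cases s <;> simp_all <;> ring

/-- An excursion has as many right as left steps and its closing descent as many steps as there are
up steps, so the half-perimeter is one more than the number of left and up steps. -/
theorem mem_polygons_right_iff {n : ℕ} (hn : 1 ≤ n) {w : List Step} :
    w ∈ twoSidedPolygons (n + 1) ∧ endpoint w = (1, 0) ↔
      w = downUp n ∨ w ∈ closeDown '' excursions .up 0 n := by
  constructor
  · rintro ⟨⟨h, hper⟩, he⟩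
    have hr : EndsOnRight w := by
      rcases h.endpoint_cases with h | h
      · exact h.2
      · exact absurd (he.symm.trans h.1) (by decide)
    rw [perimeter] at hper
    rcases h.1.eq_downUp_or_closeDown hr h.2.1 he with ⟨k, hk, rfl⟩ | ⟨p, hp, hu, hp0, rfl⟩
    · left
      simp [downUp] at hper
      congr 1
      lia
    · refine Or.inr ⟨p, ⟨hu, hp0, ?_⟩, rfl⟩
      have h1 := endpoint_fst_eq_count p
      have h2 := length_eq_count hu.1
      simp [closeDown] at hper
      lia
  · rintro (rfl | ⟨p, ⟨hu, hp0, hc⟩, rfl⟩)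
    · have he : endpoint (downUp n) = (1, 0) := by
        rw [downUp, endpoint_append, endpoint_cons, endpoint_replicate, endpoint_replicate]
        ext <;> simp [Step.vec]
      refine ⟨⟨⟨(isTwoSidedWalk_downUp n n).1, ?_, .right, he⟩, ?_⟩, he⟩
      · simp [downUp]
        lia
      · simp [downUp, perimeter]
        lia
    · have he : endpoint (closeDown p) = (1, 0) := by
        rw [closeDown, endpoint_append, endpoint_cons, endpoint_replicate]
        have := endpoint_snd_eq_count hu.1
        ext <;> simp [Step.vec, hp0, this]
      have h1 := endpoint_fst_eq_count p
      have h2 := length_eq_count hu.1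
      refine ⟨⟨⟨(isTwoSidedWalk_closeDown hu hp0 _).1, ?_, .right, he⟩, ?_⟩, he⟩
      · simp [closeDown]
        lia
      · simp [closeDown, perimeter]
        lia

theorem closeDown_injOn (j : ℤ) (n : ℕ) : Set.InjOn closeDown (excursions .up j n) := by
  intro p hp q hq h
  have hcount : ∀ r ∈ excursions .up j n, (closeDown r).count .down = r.count .up := by
    intro r hr
    simp [closeDown, List.count_eq_zero_of_not_mem hr.1.1]
  have hc : p.count .up = q.count .up := by rw [← hcount p hp, ← hcount q hq, h]
  rw [closeDown, closeDown, hc] at h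
  exact List.append_cancel_right h

theorem downUp_notMem {n : ℕ} (hn : 1 ≤ n) : downUp n ∉ closeDown '' excursions .up 0 n := by
  rintro ⟨p, ⟨hu, hp0, hc⟩, h⟩
  obtain ⟨n, rfl⟩ := Nat.exists_eq_add_of_le' hn
  rcases p with _ | ⟨s, p⟩
  · simp at hc
  · rw [closeDown, downUp, List.replicate_succ, List.cons_append, List.cons_append] at h
    have : s = .down := (List.cons.inj h).1
    exact hu.1 (by simp [this])

theorem excursions_finite (a : Step) (j : ℤ) (n : ℕ) : (excursions a j n).Finite := by
  refine (List.finite_length_le Step (2 * n + j.toNat)).subset ?_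
  rintro w ⟨hu, hj, hc⟩
  have h1 := endpoint_fst_eq_count w
  have h2 := length_eq_count hu.1
  change w.length ≤ _
  lia

/-- The factor $2$ is the reflection in the diagonal; the summand $1$ is the down–right–up polygon.
-/
theorem pp₂_succ {n : ℕ} (hn : 1 ≤ n) : pp₂ (n + 1) = 2 * ((excursions .up 0 n).ncard + 1) := by
  have hfin := finite_twoSidedPolygons (n + 1)
  set R := {w | w ∈ twoSidedPolygons (n + 1) ∧ endpoint w = (1, 0)} with hR
  have hcard : R.ncard = (excursions .up 0 n).ncard + 1 := by
    have : R = insert (downUp n) (closeDown '' excursions .up 0 n) := by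
      ext w
      exact mem_polygons_right_iff hn
    rw [this, Set.ncard_insert_of_notMem (downUp_notMem hn) ((excursions_finite _ _ _).image _),
      (closeDown_injOn 0 n).ncard_image]
  have hswap : Function.Injective (List.map Step.swap) :=
    Function.LeftInverse.injective map_swap_map_swap
  have hRT : twoSidedPolygons (n + 1) = R ∪ List.map Step.swap '' R := by
    ext w
    constructor
    · intro hw
      rcases hw.1.endpoint_cases with h | h
      · exact Or.inl ⟨hw, h.1⟩
      · refine Or.inr ⟨w.map Step.swap, ⟨⟨hw.1.map_swap, ?_⟩, ?_⟩, map_swap_map_swap w⟩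
        · simpa [perimeter] using hw.2
        · rw [endpoint_map_swap, h.1]
          rfl
    · rintro (hw | ⟨w, hw, rfl⟩)
      · exact hw.1
      · exact ⟨hw.1.1.map_swap, by simpa [perimeter] using hw.1.2⟩
  have hdisj : Disjoint R (List.map Step.swap '' R) := by
    rw [Set.disjoint_left]
    rintro _ h ⟨w, hw, rfl⟩
    have h2 := h.2
    rw [endpoint_map_swap, hw.2] at h2
    exact absurd h2 (by decide)
  have hRfin : R.Finite := hfin.subset fun w hw => hw.1
  rw [pp₂, hRT, Set.ncard_union_eq hdisj hRfin (hRfin.image _),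
    Set.ncard_image_of_injective _ hswap, hcard]
  ring

theorem pp₂_zero : pp₂ 0 = 0 := by
  rw [pp₂, Set.ncard_eq_zero (finite_twoSidedPolygons 0), Set.eq_empty_iff_forall_notMem]
  rintro w ⟨-, h⟩
  simp [perimeter] at h

theorem pp₂_one : pp₂ 1 = 0 := by
  rw [pp₂, Set.ncard_eq_zero (finite_twoSidedPolygons 1), Set.eq_empty_iff_forall_notMem]
  rintro w ⟨h, h'⟩
  exact h.2.1 (by simpa [perimeter] using h')

end Prudent

namespace Prudent

/-! ### Counting excursions -/

theorem _root_.Set.Finite.ncard_eq_sum_cons {α : Type*} [Fintype α] {S : Set (List α)}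
    [Decidable ([] ∈ S)] (hS : S.Finite) :
    S.ncard = (if [] ∈ S then 1 else 0) + ∑ s, {w | s :: w ∈ S}.ncard := by
  classical
  have hfin : ∀ s, {w | s :: w ∈ S}.Finite := fun s =>
    hS.preimage (List.cons_injective.injOn)
  rw [Set.ncard_eq_toFinset_card S hS,
    Finset.card_eq_sum_card_fiberwise (t := Finset.univ) (f := List.head?) (by simp),
    Fintype.sum_option]
  congr 1
  · have : hS.toFinset.filter (fun w => w.head? = none) = if [] ∈ S then {[]} else ∅ := by
      ext w
      split_ifs with h <;> simp <;> aesop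
    rw [this]
    split_ifs <;> rfl
  · refine Finset.sum_congr rfl fun s _ => ?_
    rw [Set.ncard_eq_toFinset_card _ (hfin s),
      ← Finset.card_image_of_injective (hfin s).toFinset (List.cons_injective (a := s))]
    congr 1
    ext w
    cases w with
    | nil => simp
    | cons b t =>
      simp only [Finset.mem_filter, Set.Finite.mem_toFinset, List.head?_cons, Option.some.injEq,
        Finset.mem_image, Set.mem_ofPred_eq]
      constructor
      · rintro ⟨h, rfl⟩
        exact ⟨t, h, rfl⟩
      · rintro ⟨t', h, heq⟩
        cases heq
        exact ⟨h, rfl⟩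

theorem visited_cons (s : Step) (w : List Step) :
    visited (s :: w) = insert 0 ((s.vec + ·) '' visited w) := by
  ext v
  simp only [visited, List.prefix_cons_iff, Set.mem_ofPred_eq, Set.mem_insert_iff, Set.mem_image]
  constructor
  · rintro ⟨r, rfl | ⟨t, rfl, h⟩, rfl⟩
    · exact Or.inl rfl
    · exact Or.inr ⟨_, ⟨t, h, rfl⟩, (endpoint_cons s t).symm⟩
  · rintro (rfl | ⟨_, ⟨t, h, rfl⟩, rfl⟩)
    · exact ⟨[], Or.inl rfl, rfl⟩
    · exact ⟨s :: t, Or.inr ⟨t, rfl, h⟩, endpoint_cons s t⟩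

theorem isUpward_cons {a : Step} {j : ℤ} (hj : 0 ≤ j) {s : Step} {w : List Step} :
    IsUpward a j (s :: w) ↔ a.vec + s.vec ≠ 0 ∧ s ≠ .down ∧ IsUpward s (j - s.vec.1) w := by
  have : (∀ v ∈ visited (s :: w), v.1 ≤ j) ↔ ∀ v ∈ visited w, v.1 ≤ j - s.vec.1 := by
    rw [visited_cons, Set.forall_mem_insert, Set.forall_mem_image]
    simp only [Prod.fst_zero, hj, true_and, Prod.fst_add]
    exact forall₂_congr fun v _ => by constructor <;> intro h <;> linarith
  simp only [IsUpward, this, List.isChain_cons_cons, List.mem_cons, not_or]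
  constructor
  · rintro ⟨⟨h1, h2⟩, ⟨h3, h4⟩, h5⟩
    exact ⟨h3, Ne.symm h1, h2, h4, h5⟩
  · rintro ⟨h3, h1, h2, h4, h5⟩
    exact ⟨⟨Ne.symm h1, h2⟩, ⟨h3, h4⟩, h5⟩

/-- The generating function of the excursions. -/
noncomputable def excursionSeries (a : Step) (j : ℤ) : ℂ⟦X⟧ :=
  PowerSeries.mk fun n => ((excursions a j n).ncard : ℂ)

theorem excursions_of_neg {a : Step} {j : ℤ} (hj : j < 0) (n : ℕ) : excursions a j n = ∅ := by
  rw [Set.eq_empty_iff_forall_notMem]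
  rintro w ⟨hu, -⟩
  exact absurd (hu.2.2 0 (zero_mem_visited w)) (by simpa using hj)

theorem nil_mem_excursions {a : Step} {j : ℤ} {n : ℕ} : [] ∈ excursions a j n ↔ j = 0 ∧ n = 0 := by
  simp only [excursions, Set.mem_ofPred_eq, endpoint_nil, List.count_nil]
  constructor
  · rintro ⟨-, h1, h2⟩
    exact ⟨h1.symm, h2.symm⟩
  · rintro ⟨rfl, rfl⟩
    exact ⟨isUpward_nil le_rfl, rfl, rfl⟩

theorem cons_mem_excursions {a : Step} {j : ℤ} (hj : 0 ≤ j) {n : ℕ} {s : Step} {w : List Step} :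
    s :: w ∈ excursions a j n ↔ a.vec + s.vec ≠ 0 ∧ s ≠ .down ∧ ∃ m, w ∈ excursions s (j - s.vec.1) m ∧
      n = m + if s = .right then 0 else 1 := by
  simp only [excursions, Set.mem_ofPred_eq, isUpward_cons hj, endpoint_cons, Prod.fst_add]
  constructor
  · rintro ⟨⟨h1, h2, h3⟩, h4, h5⟩
    refine ⟨h1, h2, w.count .up + w.count .left, ⟨h3, by linarith, rfl⟩, ?_⟩
    rw [← h5]
    cases s <;> simp_all <;> lia
  · rintro ⟨h1, h2, m, ⟨h3, h4, h5⟩, rfl⟩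
    refine ⟨⟨h1, h2, h3⟩, by linarith, ?_⟩
    rw [← h5]
    cases s <;> simp_all <;> lia

theorem cons_excursions_right {a : Step} (ha : a ≠ .left) {j : ℤ} (hj : 0 ≤ j) (n : ℕ) :
    {w | Step.right :: w ∈ excursions a j n} = excursions .right (j - 1) n := by
  ext w
  rw [Set.mem_ofPred_eq, cons_mem_excursions hj]
  cases a <;> simp_all [Step.vec]

theorem cons_excursions_zero {a s : Step} (hs : s ≠ .right) {j : ℤ} (hj : 0 ≤ j) :
    {w | s :: w ∈ excursions a j 0} = ∅ := by
  ext w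
  rw [Set.mem_ofPred_eq, cons_mem_excursions hj]
  simp [hs]

theorem cons_excursions_succ {a s : Step} (hs : s ≠ .right) (hd : s ≠ .down)
    (ha : a.vec + s.vec ≠ 0) {j : ℤ} (hj : 0 ≤ j) (n : ℕ) :
    {w | s :: w ∈ excursions a j (n + 1)} = excursions s (j - s.vec.1) n := by
  ext w
  rw [Set.mem_ofPred_eq, cons_mem_excursions hj]
  simp [hs, hd, ha]

theorem cons_excursions_of_eq_zero {a s : Step} (ha : a.vec + s.vec = 0) {j : ℤ} (hj : 0 ≤ j)
    (n : ℕ) : {w | s :: w ∈ excursions a j n} = ∅ := by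
  ext w
  rw [Set.mem_ofPred_eq, cons_mem_excursions hj]
  simp [ha]

theorem cons_excursions_down {a : Step} {j : ℤ} (hj : 0 ≤ j) (n : ℕ) :
    {w | Step.down :: w ∈ excursions a j n} = ∅ := by
  ext w
  rw [Set.mem_ofPred_eq, cons_mem_excursions hj]
  simp

theorem sum_step {M : Type*} [AddCommMonoid M] (f : Step → M) :
    ∑ s, f s = f .left + f .right + f .up + f .down := by
  have : (Finset.univ : Finset Step) = {.left, .right, .up, .down} := rfl
  rw [this]
  simp [add_assoc]

/-- Removing the first step of an excursion. -/
theorem excursionSeries_eq {a : Step} (ha : a ≠ .down) {j : ℤ} (hj : 0 ≤ j) :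
    excursionSeries a j = (if j = 0 then 1 else 0) + PowerSeries.X * excursionSeries .up j +
      (if a = .right then 0 else PowerSeries.X * excursionSeries .left (j + 1)) +
      (if a = .left then 0 else excursionSeries .right (j - 1)) := by
  classical
  ext n
  have hup : a.vec + Step.up.vec ≠ 0 := by cases a <;> simp_all [Step.vec]
  have hX : ∀ (b : Step) (i : ℤ), PowerSeries.coeff n (PowerSeries.X * excursionSeries b i) =
      ((match n with
        | 0 => 0
        | n + 1 => ((excursions b i n).ncard : ℂ)) : ℂ) := by
    intro b i
    cases n with
    | zero => simp
    | succ n => simp [PowerSeries.coeff_succ_X_mul, excursionSeries]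
  have h0 : PowerSeries.coeff n (excursionSeries a j) = (excursions a j n).ncard := by
    simp [excursionSeries]
  have hnil : PowerSeries.coeff n (if j = 0 then (1 : ℂ⟦X⟧) else 0) =
      if [] ∈ excursions a j n then 1 else 0 := by
    by_cases h : j = 0 <;> simp [nil_mem_excursions, h, PowerSeries.coeff_one]
  rw [h0, (excursions_finite a j n).ncard_eq_sum_cons, sum_step, cons_excursions_down hj]
  simp only [map_add, hnil]
  have hU : (({w | Step.up :: w ∈ excursions a j n}.ncard : ℕ) : ℂ) =
      PowerSeries.coeff n (PowerSeries.X * excursionSeries .up j) := by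
    rw [hX]
    cases n with
    | zero => simp [cons_excursions_zero (s := .up) (by simp) hj]
    | succ n => simp [cons_excursions_succ (s := .up) (by simp) (by simp) hup hj, Step.vec]
  have hL : (({w | Step.left :: w ∈ excursions a j n}.ncard : ℕ) : ℂ) =
      PowerSeries.coeff n
        (if a = .right then 0 else PowerSeries.X * excursionSeries .left (j + 1)) := by
    split_ifs with h
    · subst h
      simp [cons_excursions_of_eq_zero (a := .right) (s := .left) (by simp [Step.vec]) hj]
    · rw [hX]
      have hleft : a.vec + Step.left.vec ≠ 0 := by cases a <;> simp_all [Step.vec]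
      cases n with
      | zero => simp [cons_excursions_zero (s := .left) (by simp) hj]
      | succ n => simp [cons_excursions_succ (s := .left) (by simp) (by simp) hleft hj, Step.vec]
  have hR : (({w | Step.right :: w ∈ excursions a j n}.ncard : ℕ) : ℂ) =
      PowerSeries.coeff n (if a = .left then 0 else excursionSeries .right (j - 1)) := by
    split_ifs with h
    · subst h
      simp [cons_excursions_of_eq_zero (a := .left) (s := .right) (by simp [Step.vec]) hj]
    · rw [cons_excursions_right h hj]
      simp [excursionSeries]
  push_cast
  rw [hU, hL, hR]
  simp
  ring

theorem excursionSeries_of_neg (a : Step) {j : ℤ} (hj : j < 0) : excursionSeries a j = 0 := by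
  ext n
  simp [excursionSeries, excursions_of_neg hj]

/-- The linear system satisfied by the generating functions of the excursions, according to the
depth of the starting point, has only one solution. -/
theorem eq_zero_of_linear_system {R : Type*} [CommRing R] {A B C : ℕ → R⟦X⟧}
    (hA0 : A 0 = PowerSeries.X * A 0 + PowerSeries.X * B 0)
    (hA : ∀ j, A (j + 1) = C j + PowerSeries.X * A (j + 1) + PowerSeries.X * B (j + 1))
    (hB : ∀ j, B j = PowerSeries.X * A (j + 1) + PowerSeries.X * B (j + 1))
    (hC0 : C 0 = PowerSeries.X * A 0)
    (hC : ∀ j, C (j + 1) = C j + PowerSeries.X * A (j + 1)) (j : ℕ) :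
    A j = 0 ∧ B j = 0 ∧ C j = 0 := by
  suffices h : ∀ n j, PowerSeries.coeff n (A j) = 0 ∧ PowerSeries.coeff n (B j) = 0 ∧
      PowerSeries.coeff n (C j) = 0 by
    refine ⟨?_, ?_, ?_⟩ <;> ext n
    exacts [(h n j).1, (h n j).2.1, (h n j).2.2]
  -- Apart from `C`, every unknown on the right carries a factor `X`, so coefficient $n$ is
  -- determined by coefficient $n-1$. The occurrences of `C` without this factor are removed by an
  -- inner induction on the depth.
  have key : ∀ n, (∀ j, PowerSeries.coeff n (PowerSeries.X * A j) = 0) →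
      (∀ j, PowerSeries.coeff n (PowerSeries.X * B j) = 0) →
      ∀ j, PowerSeries.coeff n (A j) = 0 ∧ PowerSeries.coeff n (B j) = 0 ∧
        PowerSeries.coeff n (C j) = 0 := by
    intro n hXA hXB
    have hCn : ∀ j, PowerSeries.coeff n (C j) = 0 := by
      intro j
      induction j with
      | zero => rw [hC0, hXA]
      | succ j ih => rw [hC, map_add, ih, hXA, add_zero]
    intro j
    refine ⟨?_, by rw [hB, map_add, hXA, hXB, add_zero], hCn j⟩
    cases j with
    | zero => rw [hA0, map_add, hXA, hXB, add_zero]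
    | succ j => rw [hA, map_add, map_add, hXA, hXB, hCn, add_zero, add_zero]
  intro n
  induction n with
  | zero => exact key 0 (by simp) (by simp)
  | succ n ih =>
    exact key (n + 1) (fun j => by rw [PowerSeries.coeff_succ_X_mul]; exact (ih j).1)
      (fun j => by rw [PowerSeries.coeff_succ_X_mul]; exact (ih j).2.1)

/-- The algebraic equation of the generating function of the excursions that start and end in the
column of abscissa zero. -/
theorem excursionSeries_quadratic :
    excursionSeries .up 0 = 1 + PowerSeries.X * excursionSeries .up 0 +
      PowerSeries.X * (1 + PowerSeries.X * excursionSeries .up 0) *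
        (excursionSeries .up 0 - 1) := by
  obtain ⟨A, hAd⟩ : ∃ A : ℕ → ℂ⟦X⟧, ∀ j, A j = excursionSeries .up j := ⟨_, fun _ => rfl⟩
  -- The index is shifted because the depth after a left step is at least $1$.
  obtain ⟨B, hBd⟩ : ∃ B : ℕ → ℂ⟦X⟧, ∀ j, B j = excursionSeries .left (j + 1) :=
    ⟨_, fun _ => rfl⟩
  obtain ⟨C, hCd⟩ : ∃ C : ℕ → ℂ⟦X⟧, ∀ j, C j = excursionSeries .right j := ⟨_, fun _ => rfl⟩
  have hne (j : ℕ) : (j : ℤ) + 1 ≠ 0 := by positivity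
  have hA0 : A 0 = 1 + PowerSeries.X * A 0 + PowerSeries.X * B 0 := by
    have := excursionSeries_eq (a := .up) (by simp) (le_refl 0)
    simp [excursionSeries_of_neg] at this
    simpa [hAd, hBd] using this
  have hA : ∀ j, A (j + 1) = C j + PowerSeries.X * A (j + 1) + PowerSeries.X * B (j + 1) := by
    intro j
    have := excursionSeries_eq (a := .up) (by simp) (j := (j : ℤ) + 1) (by positivity)
    simp [hne] at this
    simp only [hAd, hBd, hCd]
    push_cast
    linear_combination this
  have hB : ∀ j, B j = PowerSeries.X * A (j + 1) + PowerSeries.X * B (j + 1) := by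
    intro j
    have := excursionSeries_eq (a := .left) (by simp) (j := (j : ℤ) + 1) (by positivity)
    simp [hne] at this
    simp only [hAd, hBd]
    push_cast
    linear_combination this
  have hC0 : C 0 = 1 + PowerSeries.X * A 0 := by
    have := excursionSeries_eq (a := .right) (by simp) (le_refl 0)
    simp [excursionSeries_of_neg] at this
    simpa [hAd, hCd] using this
  have hC : ∀ j, C (j + 1) = C j + PowerSeries.X * A (j + 1) := by
    intro j
    have := excursionSeries_eq (a := .right) (by simp) (j := (j : ℤ) + 1) (by positivity)
    simp [hne] at this
    simp only [hAd, hCd]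
    push_cast
    linear_combination this
  -- First-passage factorization in algebraic form: a walk from depth $j+1$ is one from depth $j$,
  -- relative to the column before the last, followed by a right step and a walk counted by `C 0`.
  -- The shifted family and `C 0` times the original one obey the same recursion, so their
  -- difference solves the homogeneous system.
  have hlin := eq_zero_of_linear_system (A := fun j => A (j + 1) - C 0 * A j)
    (B := fun j => B (j + 1) - C 0 * B j) (C := fun j => C (j + 1) - C 0 * C j)
    (by linear_combination hA 0 - C 0 * hA0) (fun j => by linear_combination hA (j + 1) - C 0 * hA j)
    (fun j => by linear_combination hB (j + 1) - C 0 * hB j)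
    (by linear_combination hC 0 - C 0 * hC0) (fun j => by linear_combination hC (j + 1) - C 0 * hC j)
  have h1 : A 1 = C 0 * A 0 := sub_eq_zero.1 (hlin 0).1
  have h2 : B 1 = C 0 * B 0 := sub_eq_zero.1 (hlin 0).2.1
  rw [show excursionSeries .up 0 = A 0 by simp [hAd]]
  linear_combination hA0 + PowerSeries.X * (hB 0 + PowerSeries.X * h1 + PowerSeries.X * h2) -
    PowerSeries.X * C 0 * hA0 + PowerSeries.X * (A 0 - 1) * hC0

end Prudent

namespace Prudent

/-! ### Power series and the functions that they represent -/

/-- The power series `F` converges to the function `f` on the disc of radius `r`. -/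
def HasSumOnBall (F : ℂ⟦X⟧) (f : ℂ → ℂ) (r : ℝ) : Prop :=
  ∀ z : ℂ, ‖z‖ < r → HasSum (fun n => F.coeff n * z ^ n) (f z)

namespace HasSumOnBall

variable {F G : ℂ⟦X⟧} {f g : ℂ → ℂ} {r r' : ℝ}

theorem mono (h : HasSumOnBall F f r) (hr : r' ≤ r) : HasSumOnBall F f r' := fun z hz =>
  h z (hz.trans_le hr)

theorem add (hF : HasSumOnBall F f r) (hG : HasSumOnBall G g r) :
    HasSumOnBall (F + G) (fun z => f z + g z) r := fun z hz => by
  simpa only [map_add, add_mul] using (hF z hz).add (hG z hz)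

theorem sub (hF : HasSumOnBall F f r) (hG : HasSumOnBall G g r) :
    HasSumOnBall (F - G) (fun z => f z - g z) r := fun z hz => by
  simpa only [map_sub, sub_mul] using (hF z hz).sub (hG z hz)

theorem mul (hF : HasSumOnBall F f r) (hG : HasSumOnBall G g r) :
    HasSumOnBall (F * G) (fun z => f z * g z) r := fun z hz => by
  have h1 := (hF z hz).summable.norm
  have h2 := (hG z hz).summable.norm
  have hterm : (fun n => PowerSeries.coeff n (F * G) * z ^ n) = fun n =>
      ∑ p ∈ Finset.HasAntidiagonal.antidiagonal n, F.coeff p.1 * z ^ p.1 * (G.coeff p.2 * z ^ p.2) := by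
    ext n
    rw [PowerSeries.coeff_mul, Finset.sum_mul]
    refine Finset.sum_congr rfl fun p hp => ?_
    rw [← Finset.HasAntidiagonal.mem_antidiagonal.1 hp, pow_add]
    ring
  rw [hterm]
  have hs := (summable_norm_sum_mul_antidiagonal_of_summable_norm h1 h2).of_norm
  have := hs.hasSum
  rwa [← tsum_mul_tsum_eq_tsum_sum_antidiagonal_of_summable_norm h1 h2, (hF z hz).tsum_eq,
    (hG z hz).tsum_eq] at this

theorem congr (hF : HasSumOnBall F f r) (h : ∀ z, ‖z‖ < r → f z = g z) : HasSumOnBall F g r :=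
  fun z hz => h z hz ▸ hF z hz

/-- Uniqueness of Taylor coefficients; it reduces identities between series to pointwise identities
between functions. -/
theorem eq (hr : 0 < r) (hF : HasSumOnBall F f r) (hG : HasSumOnBall G f r) : F = G := by
  have key : ∀ {H : ℂ⟦X⟧}, HasSumOnBall H f r →
      HasFPowerSeriesAt f (FormalMultilinearSeries.ofScalars ℂ fun n => H.coeff n) 0 := by
    intro H hH
    rw [hasFPowerSeriesAt_iff]
    filter_upwards [Metric.ball_mem_nhds 0 hr] with z hz
    have := hH z (by simpa using hz)
    simpa [FormalMultilinearSeries.coeff_ofScalars, mul_comm] using this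
  have h := (key hF).eq_formalMultilinearSeries (key hG)
  ext n
  have := congrArg (fun p => FormalMultilinearSeries.coeff p n) h
  simpa [FormalMultilinearSeries.coeff_ofScalars] using this

theorem constantCoeff_eq (hr : 0 < r) (hF : HasSumOnBall F f r) : F.constantCoeff = f 0 := by
  have h := hF 0 (by simpa using hr)
  have h' := hasSum_single (f := fun n => F.coeff n * (0 : ℂ) ^ n) 0 (by simp +contextual)
  simpa using h'.unique h

theorem div_X (h : HasSumOnBall (PowerSeries.X * F) f r) {z : ℂ} (hz : ‖z‖ < r) (hz0 : z ≠ 0) :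
    HasSum (fun n => F.coeff n * z ^ n) (f z / z) := by
  have h1 := (hasSum_nat_add_iff' 1).2 (h z hz)
  simp only [Finset.sum_range_one, PowerSeries.coeff_succ_X_mul, pow_succ] at h1
  have h2 := h1.div_const z
  simpa [← mul_assoc, hz0] using h2

theorem of_polynomial (p : Polynomial ℂ) (r : ℝ) :
    HasSumOnBall (p : ℂ⟦X⟧) (fun z => p.eval z) r := fun z _ => by
  simp only [Polynomial.coeff_coe, Polynomial.eval_eq_sum_range]
  refine hasSum_sum_of_ne_finset_zero fun n hn => ?_
  rw [Polynomial.coeff_eq_zero_of_natDegree_lt (by simpa using hn), zero_mul]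

theorem geometric : HasSumOnBall (PowerSeries.mk 1) (fun z => (1 - z)⁻¹) 1 := fun z hz => by
  simpa using hasSum_geometric_of_norm_lt_one hz

end HasSumOnBall

theorem exists_hasSumOnBall {f : ℂ → ℂ} {r : ℝ} (hf : ∀ z, ‖z‖ < r → AnalyticAt ℂ f z) :
    ∃ F, HasSumOnBall F f r := by
  refine ⟨PowerSeries.mk fun n => ((n.factorial : ℂ)⁻¹ * iteratedDeriv n f 0), fun z hz => ?_⟩
  have hd : DifferentiableOn ℂ f (Metric.ball 0 r) := fun w hw =>
    (hf w (by simpa using hw)).differentiableAt.differentiableWithinAt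
  have := Complex.hasSum_taylorSeries_on_ball hd (z := z) (by simpa using hz)
  simp only [sub_zero, smul_eq_mul] at this
  simpa only [PowerSeries.coeff_mk, mul_assoc, mul_comm (z ^ _)] using this

/-- A square root of a power series is determined by its constant coefficient. -/
theorem eq_of_sq_eq_sq {F G : ℂ⟦X⟧} (h : F ^ 2 = G ^ 2) (h0 : F.constantCoeff = G.constantCoeff)
    (hne : G.constantCoeff ≠ 0) : F = G := by
  rcases sq_eq_sq_iff_eq_or_eq_neg.1 h with h | h
  · exact h
  · exfalso
    rw [h, map_neg] at h0
    exact hne (self_eq_neg.1 h0.symm)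

/-! ### The discriminant of the quadratic equation -/

/-- The square root of the discriminant of the quadratic equation for excursions. -/
noncomputable def discriminantRoot : ℂ⟦X⟧ :=
  (1 - PowerSeries.X) ^ 2 - 2 * PowerSeries.X ^ 2 * excursionSeries .up 0

/-- For $aE^2+bE+c=0$ one has $(2aE+b)^2=b^2-4ac$; here $a=t^2$, $b=-(1-t)^2$, $c=1-t$. -/
theorem discriminantRoot_sq : discriminantRoot ^ 2 =
    (1 - PowerSeries.X) * (1 - 3 * PowerSeries.X - PowerSeries.X ^ 2 - PowerSeries.X ^ 3) := by
  have h := excursionSeries_quadratic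
  rw [discriminantRoot]
  linear_combination -4 * PowerSeries.X ^ 2 * h

theorem constantCoeff_discriminantRoot : discriminantRoot.constantCoeff = 1 := by
  simp [discriminantRoot]

theorem X_mul_PP₂ : PowerSeries.X * PP₂ =
    (1 - PowerSeries.X) ^ 2 - 2 * PowerSeries.X ^ 2 + 2 * PowerSeries.X ^ 3 * PowerSeries.mk 1 -
      discriminantRoot := by
  have h : PP₂ = PowerSeries.X * (2 * (excursionSeries .up 0 - 1)) +
      PowerSeries.X * (PowerSeries.X * (2 * PowerSeries.mk 1)) := by
    have h0 : PowerSeries.constantCoeff (excursionSeries .up 0) = 1 := by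
      have := congrArg PowerSeries.constantCoeff excursionSeries_quadratic
      simpa using this
    have h2 : (2 : ℂ⟦X⟧) = PowerSeries.C 2 := (map_ofNat PowerSeries.C 2).symm
    ext n
    rcases n with _ | _ | n
    · simp [PP₂, pp₂_zero]
    · simp [PP₂, pp₂_one, PowerSeries.coeff_succ_X_mul, h2, h0]
    · rw [map_add, PowerSeries.coeff_succ_X_mul, PowerSeries.coeff_succ_X_mul,
        PowerSeries.coeff_succ_X_mul, h2, PowerSeries.coeff_C_mul, PowerSeries.coeff_C_mul]
      simp [PP₂, pp₂_succ, excursionSeries, PowerSeries.coeff_one]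
      ring
  rw [h, discriminantRoot]
  ring

theorem pp₂_eq_coeff (n : ℕ) : (pp₂ (n + 3) : ℂ) = 2 - discriminantRoot.coeff (n + 4) := by
  have h := congrArg (PowerSeries.coeff (n + 4)) X_mul_PP₂
  have h2 : (2 : ℂ⟦X⟧) = PowerSeries.C 2 := (map_ofNat PowerSeries.C 2).symm
  have e : (1 - PowerSeries.X) ^ 2 - 2 * PowerSeries.X ^ 2 +
      2 * PowerSeries.X ^ 3 * PowerSeries.mk 1 - discriminantRoot =
      1 - 2 * PowerSeries.X - PowerSeries.X ^ 2 + PowerSeries.X ^ 3 * (2 * PowerSeries.mk 1) -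
        discriminantRoot := by ring
  rw [e, PowerSeries.coeff_succ_X_mul, map_sub, map_add, map_sub, map_sub,
    show n + 4 = (n + 1) + 3 by ring, PowerSeries.coeff_X_pow_mul, h2, PowerSeries.coeff_C_mul,
    PowerSeries.coeff_C_mul] at h
  simpa [PP₂, PowerSeries.coeff_one, PowerSeries.coeff_X, PowerSeries.coeff_X_pow] using h

/-! ### The analytic factorization of the root of the discriminant -/

theorem cpow_half_sq (z : ℂ) : (z ^ (1 / 2 : ℂ)) ^ 2 = z := by
  simp

/-- The factor of the root of the discriminant that is analytic in the unit disc. -/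
noncomputable def regularFactor (ρ : ℝ) (z : ℂ) : ℂ :=
  (1 - z) ^ (1 / 2 : ℂ) * (1 + ρ * (1 + ρ) * z + ρ * z ^ 2) ^ (1 / 2 : ℂ)

theorem one_sub_mem_slitPlane {z : ℂ} (h : ‖z‖ ≤ 1) (hne : z ≠ 1) : 1 - z ∈ Complex.slitPlane := by
  left
  have hre := (Complex.re_le_norm z).trans h
  rcases hre.lt_or_eq with h1 | h1
  · simpa using h1
  · refine absurd (Complex.ext h1 ?_) hne
    have hsq := Complex.sq_norm z
    rw [Complex.normSq_apply, h1] at hsq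
    have : z.im * z.im ≤ 0 := by nlinarith [norm_nonneg z]
    simpa using mul_self_eq_zero.1 (le_antisymm this (mul_self_nonneg _))

theorem analyticAt_regularFactor {ρ : ℝ} (h0 : 0 < ρ) (h1 : ρ < 2 / 5) {z : ℂ} (hz : ‖z‖ < 1) :
    AnalyticAt ℂ (regularFactor ρ) z := by
  have hq : (1 + ρ * (1 + ρ) * z + ρ * z ^ 2 : ℂ) ∈ Complex.slitPlane := by
    left
    have hn : ‖(ρ * (1 + ρ) * z + ρ * z ^ 2 : ℂ)‖ ≤ ρ * (1 + ρ) + ρ := by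
      refine (norm_add_le _ _).trans ?_
      have e1 : ‖(ρ * (1 + ρ) : ℂ)‖ = ρ * (1 + ρ) := by
        rw [← Complex.ofReal_one, ← Complex.ofReal_add, ← Complex.ofReal_mul, Complex.norm_real,
          Real.norm_of_nonneg (by positivity)]
      rw [norm_mul (ρ * (1 + ρ) : ℂ), norm_mul (ρ : ℂ) (z ^ 2), e1, Complex.norm_real, norm_pow, Real.norm_of_nonneg h0.le]
      refine add_le_add ?_ ?_
      · exact mul_le_of_le_one_right (by positivity) hz.le
      · exact mul_le_of_le_one_right h0.le (pow_le_one₀ (norm_nonneg _) hz.le)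
    have := (Complex.abs_re_le_norm (ρ * (1 + ρ) * z + ρ * z ^ 2 : ℂ)).trans hn
    -- This is where the bound $2/5$ is used: $\rho^2+2\rho<1$ keeps the quadratic factor in the
    -- right half-plane.
    have hlt : ρ * (1 + ρ) + ρ < 1 := by nlinarith
    have := (abs_le.1 this).1
    rw [add_assoc, Complex.add_re, Complex.one_re]
    linarith
  refine AnalyticAt.mul (AnalyticAt.cpow ?_ analyticAt_const ?_)
    (AnalyticAt.cpow ?_ analyticAt_const hq)
  · fun_prop
  · exact one_sub_mem_slitPlane hz.le (by rintro rfl; simp at hz)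
  · fun_prop

/-- Since $1/\rho=3+\rho+\rho^2$, the cubic factors as $(1-z/\rho)(1+\rho(1+\rho)z+\rho z^2)$. -/
theorem regularFactor_mul_sq {ρ : ℝ} (h0 : ρ ≠ 0) (hρ : 1 - 3 * ρ - ρ ^ 2 - ρ ^ 3 = 0) (z : ℂ) :
    (regularFactor ρ z * (1 - z / ρ) ^ (1 / 2 : ℂ)) ^ 2 =
      (1 - z) * (1 - 3 * z - z ^ 2 - z ^ 3) := by
  have hρ' : (1 - 3 * ρ - ρ ^ 2 - ρ ^ 3 : ℂ) = 0 := by exact_mod_cast congrArg Complex.ofReal hρ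
  have h0' : (ρ : ℂ) ≠ 0 := by exact_mod_cast h0
  rw [regularFactor, mul_pow, mul_pow, cpow_half_sq, cpow_half_sq, cpow_half_sq]
  field_simp
  linear_combination -(1 - z) * z * hρ'

theorem analyticAt_sqrt_one_sub_div {ρ : ℝ} (h0 : 0 < ρ) {z : ℂ} (hz : ‖z‖ ≤ ρ) (hne : z ≠ ρ) :
    AnalyticAt ℂ (fun z : ℂ => (1 - z / ρ) ^ (1 / 2 : ℂ)) z := by
  have h0' : (ρ : ℂ) ≠ 0 := by exact_mod_cast h0.ne'
  refine AnalyticAt.cpow ?_ analyticAt_const (one_sub_mem_slitPlane ?_ ?_)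
  · fun_prop
  · rw [norm_div, Complex.norm_real, Real.norm_of_nonneg h0.le]
    exact (div_le_one h0).2 hz
  · rwa [ne_eq, div_eq_one_iff_eq h0']

/-- The power series of `√(1 - t / ρ)`. -/
noncomputable def sqrtSeries (ρ : ℝ) : ℂ⟦X⟧ :=
  1 - PowerSeries.X * (PowerSeries.C (2 * (4 * ρ : ℂ)⁻¹) *
    PowerSeries.mk fun n => (catalan n : ℂ) * ((4 * ρ : ℂ)⁻¹) ^ n)

theorem coeff_succ_sqrtSeries (ρ : ℝ) (n : ℕ) :
    (sqrtSeries ρ).coeff (n + 1) = -2 * catalan n * ((4 * ρ : ℂ)⁻¹) ^ (n + 1) := by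
  rw [sqrtSeries, map_sub, PowerSeries.coeff_succ_X_mul, PowerSeries.coeff_C_mul]
  simp [PowerSeries.coeff_one]
  ring

/-- With $C=1+xC^2$ for the Catalan series, $(1-2xC)^2=1-4x$; then $x=t/(4\rho)$. -/
theorem sqrtSeries_sq (ρ : ℝ) : sqrtSeries ρ ^ 2 = 1 - PowerSeries.C (ρ : ℂ)⁻¹ * PowerSeries.X := by
  set a : ℂ := (4 * ρ : ℂ)⁻¹ with ha
  set K : ℂ⟦X⟧ := PowerSeries.mk fun n => (catalan n : ℂ) * a ^ n with hK
  have hcat : K ^ 2 * (PowerSeries.C a * PowerSeries.X) + 1 = K := by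
    have h := congrArg (fun F => PowerSeries.rescale a (PowerSeries.map (Nat.castRingHom ℂ) F))
      PowerSeries.catalanSeries_sq_mul_X_add_one
    have hK' : PowerSeries.rescale a (PowerSeries.map (Nat.castRingHom ℂ)
        PowerSeries.catalanSeries) = K := by
      ext n
      simp [hK, PowerSeries.coeff_rescale, mul_comm]
    simpa only [map_add, map_mul, map_pow, map_one, hK', PowerSeries.map_X,
      PowerSeries.rescale_X] using h
  have hρ : (ρ : ℂ)⁻¹ = 4 * a := by
    rw [ha, mul_inv]
    ring
  rw [sqrtSeries, ← ha, ← hK, hρ, map_mul, map_mul]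
  simp only [map_ofNat]
  linear_combination 4 * PowerSeries.C a * PowerSeries.X * hcat

/-- The Taylor series of the principal root and the Catalan expression have the same square and
constant term $1$, so they agree. -/
theorem hasSumOnBall_sqrtSeries {ρ : ℝ} (h0 : 0 < ρ) :
    HasSumOnBall (sqrtSeries ρ) (fun z => (1 - z / ρ) ^ (1 / 2 : ℂ)) ρ := by
  obtain ⟨F, hF⟩ := exists_hasSumOnBall (f := fun z : ℂ => (1 - z / ρ) ^ (1 / 2 : ℂ)) (r := ρ)
    fun z hz => analyticAt_sqrt_one_sub_div h0 hz.le (by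
      rintro rfl
      simp [abs_of_pos h0] at hz)
  convert hF
  have hF0 : F.constantCoeff = 1 := by simpa using hF.constantCoeff_eq h0
  refine eq_of_sq_eq_sq ?_ (by rw [hF0]; simp [sqrtSeries]) (by simp [hF0])
  have hp := HasSumOnBall.of_polynomial (1 - Polynomial.C (ρ : ℂ)⁻¹ * Polynomial.X) ρ
  rw [sqrtSeries_sq, pow_two]
  refine HasSumOnBall.eq h0 ?_ (hF.mul hF)
  have hp' := hp.congr (g := fun z => (1 - z / ρ) ^ (1 / 2 : ℂ) * (1 - z / ρ) ^ (1 / 2 : ℂ))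
    fun z _ => by
      rw [← pow_two, cpow_half_sq]
      simp
      ring
  simpa using hp'

/-- The factorization is checked on squares, so convergence of `discriminantRoot` itself is never
needed; the common constant term $1$ fixes the sign. -/
theorem exists_discriminantRoot_eq_mul {ρ : ℝ} (h0 : 0 < ρ) (h1 : ρ < 2 / 5)
    (hρ : 1 - 3 * ρ - ρ ^ 2 - ρ ^ 3 = 0) :
    ∃ K, HasSumOnBall K (regularFactor ρ) 1 ∧ discriminantRoot = K * sqrtSeries ρ := by
  obtain ⟨K, hK⟩ := exists_hasSumOnBall (f := regularFactor ρ) (r := 1)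
    fun z hz => analyticAt_regularFactor h0 h1 hz
  refine ⟨K, hK, ?_⟩
  have hK0 : K.constantCoeff = 1 := by
    simpa [regularFactor] using hK.constantCoeff_eq one_pos
  have hc : (K * sqrtSeries ρ).constantCoeff = 1 := by simp [hK0, sqrtSeries]
  refine eq_of_sq_eq_sq ?_ (by rw [hc, constantCoeff_discriminantRoot]) (by simp [hc])
  have hprod := (hK.mono (by linarith : ρ ≤ 1)).mul (hasSumOnBall_sqrtSeries h0)
  rw [pow_two (K * sqrtSeries ρ)]
  refine HasSumOnBall.eq h0 ?_ (hprod.mul hprod)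
  have hp := (HasSumOnBall.of_polynomial
    ((1 - Polynomial.X) * (1 - 3 * Polynomial.X - Polynomial.X ^ 2 - Polynomial.X ^ 3)) ρ).congr
    (g := fun z => regularFactor ρ z * (1 - z / ρ) ^ (1 / 2 : ℂ) *
      (regularFactor ρ z * (1 - z / ρ) ^ (1 / 2 : ℂ)))
    fun z _ => by
      rw [← pow_two, regularFactor_mul_sq h0.ne' hρ]
      simp
  rw [discriminantRoot_sq]
  have h3 : ((3 : Polynomial ℂ) : ℂ⟦X⟧) = 3 :=
    map_ofNat Polynomial.coeToPowerSeries.ringHom 3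
  simpa [h3] using hp

end Prudent

namespace Prudent

/-! ### Asymptotics of the coefficients -/

/-- Stirling's sequence at $2n$ divided by the square of its value at $n$ is this expression. -/
theorem tendsto_centralBinom :
    Tendsto (fun n : ℕ => (n.centralBinom : ℝ) / 4 ^ n * √n) atTop (𝓝 (1 / √Real.pi)) := by
  have h1 := Stirling.tendsto_stirlingSeq_sqrt_pi
  have h2 : Tendsto (fun n : ℕ => Stirling.stirlingSeq (2 * n)) atTop (𝓝 √Real.pi) :=
    h1.comp (tendsto_id.const_mul_atTop' two_pos)
  have hpi : √Real.pi ≠ 0 := by positivity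
  have h3 := h2.div (h1.pow 2) (pow_ne_zero 2 hpi)
  have e : √Real.pi / √Real.pi ^ 2 = 1 / √Real.pi := by field_simp
  rw [e] at h3
  refine h3.congr' ?_
  filter_upwards [eventually_gt_atTop 0] with n hn
  have hn' : (0 : ℝ) < n := by exact_mod_cast hn
  have hc : (n.centralBinom : ℝ) = (2 * n).factorial / (n.factorial : ℝ) ^ 2 := by
    rw [Nat.centralBinom, Nat.cast_choose ℝ (by lia)]
    have : 2 * n - n = n := by lia
    rw [this, pow_two]
  have hs : √(2 * (2 * n : ℝ)) = 2 * √n := by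
    rw [← mul_assoc, Real.sqrt_mul (by norm_num)]
    congr 1
    rw [show (2 * 2 : ℝ) = 2 ^ 2 by norm_num, Real.sqrt_sq (by norm_num)]
  have hs2 : √(2 * n : ℝ) ^ 2 = 2 * (√n * √n) := by
    rw [Real.sq_sqrt (by positivity), Real.mul_self_sqrt hn'.le]
  have hsn : 0 < √(n : ℝ) := Real.sqrt_pos.2 hn'
  have hp : ((2 * n : ℝ) / Real.exp 1) ^ (2 * n) = 4 ^ n * (((n : ℝ) / Real.exp 1) ^ n) ^ 2 := by
    rw [mul_div_assoc, mul_pow, pow_mul, ← pow_mul _ n 2, mul_comm n 2]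
    norm_num
  simp only [Pi.div_apply, Stirling.stirlingSeq, Nat.cast_mul, Nat.cast_ofNat]
  rw [hc, hs, hp, div_pow (n.factorial : ℝ), mul_pow √(2 * n : ℝ), hs2]
  have : ((n : ℝ) / Real.exp 1) ^ n ≠ 0 := by positivity
  have : (n.factorial : ℝ) ≠ 0 := by positivity
  field_simp

theorem tendsto_natCast_add_div (i : ℕ) :
    Tendsto (fun n : ℕ => ((n + i : ℕ) : ℝ) / n) atTop (𝓝 1) := by
  have h : Tendsto (fun n : ℕ => 1 + (i : ℝ) / n) atTop (𝓝 (1 + 0)) :=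
    (tendsto_const_div_atTop_nhds_zero_nat (i : ℝ)).const_add 1
  rw [add_zero] at h
  refine h.congr' ?_
  filter_upwards [eventually_gt_atTop 0] with n hn
  have hn' : (n : ℝ) ≠ 0 := by exact_mod_cast hn.ne'
  push_cast
  field_simp

theorem tendsto_coeff_sqrt : Tendsto (fun n : ℕ => ((n + 1 : ℕ) : ℝ) ^ (3 / 2 : ℝ) *
    (-2 * catalan n * (4⁻¹ : ℝ) ^ (n + 1))) atTop (𝓝 (-(1 / (2 * √Real.pi)))) := by
  have h := ((tendsto_natCast_add_div 1).sqrt.mul tendsto_centralBinom).const_mul (-(1 / 2) : ℝ)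
  rw [Real.sqrt_one] at h
  have e : -(1 / 2) * (1 * (1 / √Real.pi)) = -(1 / (2 * √Real.pi)) := by field_simp
  rw [e] at h
  refine h.congr' ?_
  filter_upwards [eventually_gt_atTop 0] with n hn
  have hn' : (0 : ℝ) < n := by exact_mod_cast hn
  have hc : (catalan n : ℝ) = n.centralBinom / ((n + 1 : ℕ) : ℝ) := by
    rw [eq_div_iff (by positivity), ← succ_mul_catalan_eq_centralBinom]
    push_cast
    ring
  have hp : ((n + 1 : ℕ) : ℝ) ^ (3 / 2 : ℝ) = ((n + 1 : ℕ) : ℝ) * √((n + 1 : ℕ) : ℝ) := by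
    rw [show (3 / 2 : ℝ) = 1 + 1 / 2 by norm_num, Real.rpow_add (by positivity), Real.rpow_one,
      Real.sqrt_eq_rpow]
  rw [hc, hp, Real.sqrt_div (by positivity), pow_succ, inv_pow]
  have : √(n : ℝ) ≠ 0 := (Real.sqrt_pos.2 hn').ne'
  field_simp
  norm_num
  ring

/-- The Cauchy product of a rapidly decreasing sequence and a sequence of size `n ^ (-α)`. -/
theorem tendsto_cauchyProduct {a u : ℕ → ℂ} {α : ℝ} (h0 : 0 ≤ α) (h2 : α ≤ 2) {L : ℂ}
    (ha : Summable fun i => ‖a i‖ * ((i : ℝ) + 1) ^ 2)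
    (hu : Tendsto (fun n : ℕ => (((n : ℝ) ^ α : ℝ) : ℂ) * u n) atTop (𝓝 L)) :
    Tendsto (fun n : ℕ => (((n : ℝ) ^ α : ℝ) : ℂ) *
      ∑ p ∈ Finset.HasAntidiagonal.antidiagonal n, a p.1 * u p.2) atTop (𝓝 ((∑' i, a i) * L)) := by
  have hratio (i : ℕ) : Tendsto (fun n : ℕ => ((((n + i : ℕ) : ℝ) ^ α / (n : ℝ) ^ α : ℝ) : ℂ))
      atTop (𝓝 1) := by
    have h := (tendsto_natCast_add_div i).rpow_const (p := α) (Or.inr h0)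
    rw [Real.one_rpow] at h
    have h' := (Complex.continuous_ofReal.tendsto 1).comp h
    refine h'.congr fun n => ?_
    simp only [Function.comp_apply]
    rw [Real.div_rpow (by positivity) (by positivity)]
  -- The weight $n^\alpha$ may vanish at $n=0$; with $(n+1)^\alpha$ convergence bounds every term of
  -- `u`.
  have hu1 : Tendsto (fun n : ℕ => ((((n + 1 : ℕ) : ℝ) ^ α : ℝ) : ℂ) * u n) atTop (𝓝 L) := by
    have h := (hratio 1).mul hu
    rw [one_mul] at h
    refine h.congr' ?_
    filter_upwards [eventually_gt_atTop 0] with n hn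
    have hn' : (((n : ℝ) ^ α : ℝ) : ℂ) ≠ 0 := by
      have : (0 : ℝ) < n := by exact_mod_cast hn
      exact_mod_cast (Real.rpow_pos_of_pos this α).ne'
    push_cast
    field_simp
  obtain ⟨B, hB⟩ := hu1.norm.bddAbove_range
  have hB' : ∀ n : ℕ, ((n : ℝ) + 1) ^ α * ‖u n‖ ≤ B := by
    intro n
    have := hB ⟨n, rfl⟩
    simp only [norm_mul, Complex.norm_real] at this
    rwa [Real.norm_of_nonneg (by positivity), Nat.cast_succ] at this
  have hB0 : 0 ≤ B := le_trans (by positivity) (hB' 0)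
  have hsum : (fun n : ℕ => (((n : ℝ) ^ α : ℝ) : ℂ) *
      ∑ p ∈ Finset.HasAntidiagonal.antidiagonal n, a p.1 * u p.2) =
      fun n : ℕ => ∑' i, if i ≤ n then (((n : ℝ) ^ α : ℝ) : ℂ) * (a i * u (n - i)) else 0 := by
    ext n
    rw [tsum_eq_sum (s := Finset.range (n + 1)) (by
      intro i hi
      rw [if_neg]
      simpa using hi), Finset.Nat.sum_antidiagonal_eq_sum_range_succ_mk, Finset.mul_sum]
    refine Finset.sum_congr rfl fun i hi => ?_
    rw [if_pos (Nat.lt_succ_iff.1 (Finset.mem_range.1 hi))]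
  rw [hsum, ← tsum_mul_right]
  -- Tannery's theorem: for fixed `i` the shifted term tends to `a i * L`, and the decay of `a`
  -- dominates uniformly in `n`.
  refine tendsto_tsum_of_dominated_convergence (ha.mul_left B) (fun i => ?_)
    (Eventually.of_forall fun n i => ?_)
  · rw [← tendsto_add_atTop_iff_nat i]
    have h := ((hratio i).mul hu).const_mul (a i)
    rw [one_mul] at h
    refine h.congr' ?_
    filter_upwards [eventually_gt_atTop 0] with n hn
    have hn' : (((n : ℝ) ^ α : ℝ) : ℂ) ≠ 0 := by
      have : (0 : ℝ) < n := by exact_mod_cast hn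
      exact_mod_cast (Real.rpow_pos_of_pos this α).ne'
    rw [if_pos (by lia), Nat.add_sub_cancel]
    push_cast
    field_simp
  · split_ifs with hin
    · obtain ⟨m, rfl⟩ := Nat.exists_eq_add_of_le hin
      rw [Nat.add_sub_cancel_left, norm_mul, norm_mul, Complex.norm_real,
        Real.norm_of_nonneg (by positivity)]
      -- From $i+m\le(m+1)(i+1)$; the exponent $2\ge\alpha$ explains the weight in the hypothesis on
      -- `a`.
      have h1 : ((i + m : ℕ) : ℝ) ^ α ≤ ((m : ℝ) + 1) ^ α * ((i : ℝ) + 1) ^ 2 := by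
        calc ((i + m : ℕ) : ℝ) ^ α ≤ (((m : ℝ) + 1) * ((i : ℝ) + 1)) ^ α := by
              refine Real.rpow_le_rpow (by positivity) ?_ h0
              push_cast
              nlinarith [(Nat.cast_nonneg i : (0 : ℝ) ≤ i), (Nat.cast_nonneg m : (0 : ℝ) ≤ m)]
          _ = ((m : ℝ) + 1) ^ α * ((i : ℝ) + 1) ^ α :=
              Real.mul_rpow (by positivity) (by positivity)
          _ ≤ ((m : ℝ) + 1) ^ α * ((i : ℝ) + 1) ^ 2 := by
              gcongr
              rw [← Real.rpow_natCast]
              exact Real.rpow_le_rpow_of_exponent_le (by simp) (by simpa using h2)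
      calc ((i + m : ℕ) : ℝ) ^ α * (‖a i‖ * ‖u m‖)
          ≤ (((m : ℝ) + 1) ^ α * ((i : ℝ) + 1) ^ 2) * (‖a i‖ * ‖u m‖) := by gcongr
        _ = (((m : ℝ) + 1) ^ α * ‖u m‖) * (‖a i‖ * ((i : ℝ) + 1) ^ 2) := by ring
        _ ≤ B * (‖a i‖ * ((i : ℝ) + 1) ^ 2) := by
            gcongr
            exact hB' m
    · rw [norm_zero]
      positivity

/-- At a radius $s$ between $\|z\|$ and $r$ the terms are bounded, which leaves a geometric series
of ratio $\|z\|/s$ against a quadratic weight. -/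
theorem HasSumOnBall.summable_mul_sq {F : ℂ⟦X⟧} {f : ℂ → ℂ} {r : ℝ} (h : HasSumOnBall F f r)
    {z : ℂ} (hz : ‖z‖ < r) :
    Summable fun i => ‖F.coeff i * z ^ i‖ * ((i : ℝ) + 1) ^ 2 := by
  obtain ⟨s, hs1, hs2⟩ := exists_between hz
  have hs0 : 0 < s := (norm_nonneg z).trans_lt hs1
  have hbd : BddAbove (Set.range fun n => ‖F.coeff n * (s : ℂ) ^ n‖) :=
    (h s (by simpa [abs_of_pos hs0] using hs2)).summable.tendsto_atTop_zero.norm.bddAbove_range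
  obtain ⟨M, hM⟩ := hbd
  have hM' : ∀ n, ‖F.coeff n‖ * s ^ n ≤ M := fun n => by
    have := hM ⟨n, rfl⟩
    simpa [abs_of_pos hs0] using this
  set q := ‖z‖ / s with hq
  have hq0 : 0 ≤ q := by positivity
  have hq1 : q < 1 := (div_lt_one hs0).2 hs1
  have hgeo : Summable fun n : ℕ => ((n : ℝ) + 1) ^ 2 * q ^ n := by
    have h2 := summable_pow_mul_geometric_of_norm_lt_one 2 (r := q)
      (by rwa [Real.norm_of_nonneg hq0])
    have h1 := summable_pow_mul_geometric_of_norm_lt_one 1 (r := q)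
      (by rwa [Real.norm_of_nonneg hq0])
    have h0 := summable_geometric_of_lt_one hq0 hq1
    refine ((h2.add (h1.mul_left 2)).add h0).congr fun n => ?_
    ring
  refine Summable.of_nonneg_of_le (fun i => by positivity) (fun i => ?_) (hgeo.mul_left M)
  have e : ‖F.coeff i * z ^ i‖ * ((i : ℝ) + 1) ^ 2 =
      (‖F.coeff i‖ * s ^ i) * (((i : ℝ) + 1) ^ 2 * q ^ i) := by
    rw [norm_mul, norm_pow, hq, div_pow]
    field_simp
  rw [e]
  gcongr
  exact hM' i

theorem tendsto_coeff_discriminantRoot {ρ : ℝ} (h0 : 0 < ρ) (h1 : ρ < 2 / 5)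
    (hρ : 1 - 3 * ρ - ρ ^ 2 - ρ ^ 3 = 0) :
    Tendsto (fun n : ℕ => (((n : ℝ) ^ (3 / 2 : ℝ) : ℝ) : ℂ) *
      (discriminantRoot.coeff n * (ρ : ℂ) ^ n)) atTop
      (𝓝 (regularFactor ρ ρ * ((-(1 / (2 * √Real.pi)) : ℝ) : ℂ))) := by
  obtain ⟨K, hK, hD⟩ := exists_discriminantRoot_eq_mul h0 h1 hρ
  have hz : ‖(ρ : ℂ)‖ < 1 := by
    rw [Complex.norm_real, Real.norm_of_nonneg h0.le]
    linarith
  have hρ' : (ρ : ℂ) ≠ 0 := by exact_mod_cast h0.ne'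
  have hu : Tendsto (fun n : ℕ => (((n : ℝ) ^ (3 / 2 : ℝ) : ℝ) : ℂ) *
      ((sqrtSeries ρ).coeff n * (ρ : ℂ) ^ n)) atTop
      (𝓝 ((-(1 / (2 * √Real.pi)) : ℝ) : ℂ)) := by
    rw [← tendsto_add_atTop_iff_nat 1]
    refine ((Complex.continuous_ofReal.tendsto _).comp tendsto_coeff_sqrt).congr fun n => ?_
    simp only [Function.comp_apply]
    rw [coeff_succ_sqrtSeries, Complex.ofReal_mul]
    congr 1
    push_cast
    rw [mul_inv, mul_pow, inv_pow (ρ : ℂ)]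
    field_simp
  have h := tendsto_cauchyProduct (by norm_num) (by norm_num) (hK.summable_mul_sq hz) hu
  rw [(hK ρ hz).tsum_eq] at h
  refine h.congr fun n => ?_
  congr 1
  rw [hD, PowerSeries.coeff_mul, Finset.sum_mul]
  refine Finset.sum_congr rfl fun p hp => ?_
  rw [← Finset.HasAntidiagonal.mem_antidiagonal.1 hp, pow_add]
  ring

/-- The value of the regular factor at the dominant singularity. -/
theorem regularFactor_self {ρ : ℝ} (h0 : 0 < ρ) (h1 : ρ < 2 / 5) :
    regularFactor ρ ρ = (√((1 - ρ) * (1 + ρ * (1 + ρ) * ρ + ρ * ρ ^ 2)) : ℝ) := by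
  have e1 : (1 - ρ : ℂ) ^ (1 / 2 : ℂ) = ((1 - ρ) ^ (1 / 2 : ℝ) : ℝ) := by
    rw [Complex.ofReal_cpow (by linarith)]
    simp
  have e2 : (1 + ρ * (1 + ρ) * ρ + ρ * ρ ^ 2 : ℂ) ^ (1 / 2 : ℂ) =
      ((1 + ρ * (1 + ρ) * ρ + ρ * ρ ^ 2) ^ (1 / 2 : ℝ) : ℝ) := by
    rw [Complex.ofReal_cpow (by positivity)]
    simp
  rw [regularFactor, e1, e2, ← Complex.ofReal_mul, ← Real.sqrt_eq_rpow, ← Real.sqrt_eq_rpow,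
    Real.sqrt_mul (by linarith)]

theorem tendsto_rpow_mul_pow {q : ℝ} (h0 : 0 < q) (h1 : q < 1) :
    Tendsto (fun n : ℕ => (n : ℝ) ^ (3 / 2 : ℝ) * q ^ n) atTop (𝓝 0) := by
  refine squeeze_zero' (Eventually.of_forall fun n => by positivity) ?_
    (tendsto_pow_const_mul_const_pow_of_lt_one 2 h0.le h1)
  filter_upwards [eventually_ge_atTop 1] with n hn
  gcongr
  rw [← Real.rpow_natCast]
  exact Real.rpow_le_rpow_of_exponent_le (by exact_mod_cast hn) (by norm_num)

/-- In `pp₂_eq_coeff` the constant $2$ is negligible after scaling by $\rho^m$, and the index shift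
by one between `pp₂` and `discriminantRoot` produces the factor $1/\rho$. -/
theorem tendsto_pp₂ {ρ : ℝ} (h0 : 0 < ρ) (h1 : ρ < 2 / 5)
    (hρ : 1 - 3 * ρ - ρ ^ 2 - ρ ^ 3 = 0) :
    Tendsto (fun m : ℕ => (m : ℝ) ^ (3 / 2 : ℝ) * (pp₂ m * ρ ^ m)) atTop
      (𝓝 (√((1 - ρ) * (1 + ρ * (1 + ρ) * ρ + ρ * ρ ^ 2)) / (2 * √Real.pi * ρ))) := by
  set κ := √((1 - ρ) * (1 + ρ * (1 + ρ) * ρ + ρ * ρ ^ 2)) with hκ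
  have h := tendsto_coeff_discriminantRoot h0 h1 hρ
  rw [regularFactor_self h0 h1, ← hκ, ← tendsto_add_atTop_iff_nat 4] at h
  have hgeo3 : Tendsto (fun n : ℕ => ((n + 3 : ℕ) : ℝ) ^ (3 / 2 : ℝ) * (2 * ρ ^ (n + 3)))
      atTop (𝓝 0) := by
    have h' := ((tendsto_rpow_mul_pow h0 (by linarith)).const_mul 2).comp (tendsto_add_atTop_nat 3)
    rw [mul_zero] at h'
    refine h'.congr fun n => ?_
    simp only [Function.comp_apply]
    ring
  have hratio : Tendsto (fun n : ℕ => (((n + 3 : ℕ) : ℝ) ^ (3 / 2 : ℝ) /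
      ((n + 4 : ℕ) : ℝ) ^ (3 / 2 : ℝ))) atTop (𝓝 1) := by
    have h' := ((tendsto_natCast_add_div 1).rpow_const (p := 3 / 2)
      (Or.inr (by norm_num))).inv₀ (by simp)
    rw [Real.one_rpow, inv_one] at h'
    refine (h'.comp (tendsto_add_atTop_nat 3)).congr fun n => ?_
    simp only [Function.comp_apply]
    rw [Real.div_rpow (by positivity) (by positivity), inv_div, add_assoc]
  have hfin : Tendsto (fun n : ℕ => ((((n + 3 : ℕ) : ℝ) ^ (3 / 2 : ℝ) *
      (pp₂ (n + 3) * ρ ^ (n + 3)) : ℝ) : ℂ)) atTop (𝓝 ((κ / (2 * √Real.pi * ρ) : ℝ) : ℂ)) := by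
    have hr' := (Complex.continuous_ofReal.tendsto _).comp hratio
    have hg' := (Complex.continuous_ofReal.tendsto _).comp hgeo3
    have h4 := hg'.sub ((hr'.mul h).mul_const ((ρ : ℂ)⁻¹))
    have e : ((0 : ℝ) : ℂ) - ((1 : ℝ) : ℂ) * ((κ : ℂ) * ((-(1 / (2 * √Real.pi)) : ℝ) : ℂ)) *
        (ρ : ℂ)⁻¹ = ((κ / (2 * √Real.pi * ρ) : ℝ) : ℂ) := by
      push_cast
      field_simp
      ring
    rw [e] at h4
    refine h4.congr fun n => ?_
    have hρ' : (ρ : ℂ) ≠ 0 := by exact_mod_cast h0.ne'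
    have hne : ((((n + 4 : ℕ) : ℝ) ^ (3 / 2 : ℝ) : ℝ) : ℂ) ≠ 0 := by
      exact_mod_cast (Real.rpow_pos_of_pos (by positivity) _).ne'
    simp only [Function.comp_apply, Complex.ofReal_mul, Complex.ofReal_div, Complex.ofReal_pow,
      Complex.ofReal_natCast, pp₂_eq_coeff, Complex.ofReal_ofNat]
    generalize ((((n + 4 : ℕ) : ℝ) ^ (3 / 2 : ℝ) : ℝ) : ℂ) = b at hne ⊢
    field_simp
    ring
  rw [← tendsto_add_atTop_iff_nat 3]
  have := (Complex.continuous_re.tendsto _).comp hfin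
  simpa only [Function.comp_def, Complex.ofReal_re] using this

theorem pp₂_isEquivalent {ρ A : ℝ} (h0 : 0 < ρ) (hA : A ≠ 0)
    (h : Tendsto (fun m : ℕ => (m : ℝ) ^ (3 / 2 : ℝ) * (pp₂ m * ρ ^ m)) atTop (𝓝 A)) :
    (fun m : ℕ => (pp₂ m : ℝ)) ~[atTop]
      (fun m : ℕ => A * ρ ^ (-(m : ℝ)) * (m : ℝ) ^ (-(3 / 2) : ℝ)) := by
  have hev : ∀ᶠ m : ℕ in atTop, A * ρ ^ (-(m : ℝ)) * (m : ℝ) ^ (-(3 / 2) : ℝ) ≠ 0 := by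
    filter_upwards [eventually_gt_atTop 0] with m hm
    have : (0 : ℝ) < m := by exact_mod_cast hm
    positivity
  rw [isEquivalent_iff_tendsto_one hev]
  have h' := h.div_const A
  rw [div_self hA] at h'
  refine h'.congr' ?_
  filter_upwards [eventually_gt_atTop 0] with m hm
  have : (0 : ℝ) < m := by exact_mod_cast hm
  have : (0 : ℝ) < (m : ℝ) ^ (3 / 2 : ℝ) := by positivity
  simp only [Pi.div_apply]
  rw [Real.rpow_neg h0.le, Real.rpow_natCast, Real.rpow_neg (by positivity)]
  field_simp

end Prudent

namespace Prudent

/-! ### Algebraicity -/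

/-- If $F$ were rational, $p-qF$ would be a rational function with polynomial square, hence a
polynomial because $\mathbb C[t]$ is integrally closed, and `d` would be a square. -/
theorem isAlgebraicOfDegree_two {F : ℂ⟦X⟧} {p q d : Polynomial ℂ} (hq : q ≠ 0)
    (h : ((p : ℂ⟦X⟧) - q * F) ^ 2 = d) (hd : ∀ z : Polynomial ℂ, z ^ 2 ≠ d) :
    IsAlgebraicOfDegree F 2 := by
  set y : ℂ⸨X⸩ := (F : ℂ⸨X⸩) with hy
  set φ := algebraMap (RatFunc ℂ) ℂ⸨X⸩ with hφ
  set ι := algebraMap (Polynomial ℂ) (RatFunc ℂ) with hι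
  have hL : (φ (ι p) - φ (ι q) * y) ^ 2 = φ (ι d) := by
    have h' := congrArg (algebraMap ℂ⟦X⟧ ℂ⸨X⸩) h
    have hcoe : ∀ r : Polynomial ℂ, algebraMap ℂ⟦X⟧ ℂ⸨X⸩ (r : ℂ⟦X⟧) = φ (ι r) := fun r =>
      RatFunc.coe_coe r
    rw [map_pow, map_sub, map_mul, hcoe, hcoe, hcoe] at h'
    exact h'
  have hqι : ι q ≠ 0 := (map_ne_zero_iff _ (IsFractionRing.injective _ _)).2 hq
  set P : Polynomial (RatFunc ℂ) :=
    (Polynomial.C (ι p) - Polynomial.C (ι q) * Polynomial.X) ^ 2 - Polynomial.C (ι d) with hP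
  have haeval : Polynomial.aeval y P = 0 := by
    simp only [hP, map_sub, map_pow, map_mul, Polynomial.aeval_C, Polynomial.aeval_X]
    exact sub_eq_zero.2 hL
  have hcoeff : P.coeff 2 = ι q ^ 2 := by
    have e : P = Polynomial.C (ι q ^ 2) * Polynomial.X ^ 2 -
        Polynomial.C (2 * ι p * ι q) * Polynomial.X + Polynomial.C (ι p ^ 2 - ι d) := by
      rw [hP]
      simp only [map_mul, map_pow, map_sub, map_ofNat]
      ring
    rw [e]
    simp only [Polynomial.coeff_sub, Polynomial.coeff_add, Polynomial.coeff_C_mul,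
      Polynomial.coeff_X_pow, Polynomial.coeff_X, Polynomial.coeff_C]
    simp
  have hP0 : P ≠ 0 := fun h0 => pow_ne_zero 2 hqι (by rw [← hcoeff, h0, Polynomial.coeff_zero])
  have hdeg : P.natDegree ≤ 2 := by
    rw [hP]
    compute_degree
  have halg : IsAlgebraic (RatFunc ℂ) y := ⟨P, hP0, haeval⟩
  refine ⟨halg, le_antisymm ?_ ?_⟩
  · exact (Polynomial.natDegree_le_natDegree (minpoly.degree_le_of_ne_zero _ _ hP0 haeval)).trans
      hdeg
  · rw [minpoly.two_le_natDegree_iff halg.isIntegral]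
    rintro ⟨r, hr⟩
    have hr' : (ι p - ι q * r) ^ 2 = ι d := by
      apply φ.injective
      rw [map_pow, map_sub, map_mul]
      rw [← hL, ← hr]
    have hint : IsIntegral (Polynomial ℂ) ((ι p - ι q * r) ^ 2) := hr' ▸ isIntegral_algebraMap
    obtain ⟨z, hz⟩ := IsIntegrallyClosed.exists_algebraMap_eq_of_isIntegral_pow two_pos hint
    refine hd z (IsFractionRing.injective (Polynomial ℂ) (RatFunc ℂ) ?_)
    rw [map_pow, hz, hr']

/-- The root $1$ has order exactly $3$, the cubic being $-4$ there; a square has even order. -/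
theorem sq_ne_discriminant (z : Polynomial ℂ) : z ^ 2 ≠ (1 - Polynomial.X) ^ 3 *
    (1 - 3 * Polynomial.X - Polynomial.X ^ 2 - Polynomial.X ^ 3) := by
  intro h
  have hdvd : ∀ w : Polynomial ℂ, w.eval 1 = 0 → ∃ v, w = (1 - Polynomial.X) * v := by
    intro w hw
    obtain ⟨v, hv⟩ := Polynomial.dvd_iff_isRoot.2 hw
    refine ⟨-v, ?_⟩
    rw [hv, map_one]
    ring
  have hne : (1 - Polynomial.X : Polynomial ℂ) ≠ 0 := by
    intro h0
    have := congrArg (Polynomial.eval 0) h0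
    simp at this
  obtain ⟨v, rfl⟩ := hdvd z (by
    have := congrArg (Polynomial.eval 1) h
    simpa using this)
  have h1 : v ^ 2 = (1 - Polynomial.X) *
      (1 - 3 * Polynomial.X - Polynomial.X ^ 2 - Polynomial.X ^ 3) := by
    refine mul_left_cancel₀ (pow_ne_zero 2 hne) ?_
    linear_combination h
  obtain ⟨u, rfl⟩ := hdvd v (by
    have := congrArg (Polynomial.eval 1) h1
    simpa using this)
  have h2 : (1 - Polynomial.X) * u ^ 2 =
      1 - 3 * Polynomial.X - Polynomial.X ^ 2 - Polynomial.X ^ 3 := by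
    refine mul_left_cancel₀ hne ?_
    linear_combination h1
  have := congrArg (Polynomial.eval 1) h2
  norm_num at this

theorem isAlgebraicOfDegree_PP₂ : IsAlgebraicOfDegree PP₂ 2 := by
  -- These come from `X_mul_PP₂` multiplied by $1-t$ to clear the geometric series.
  refine isAlgebraicOfDegree_two
    (p := (1 - Polynomial.X) ^ 3 - 2 * Polynomial.X ^ 2 * (1 - Polynomial.X) +
      2 * Polynomial.X ^ 3)
    (q := Polynomial.X * (1 - Polynomial.X)) ?_ ?_ sq_ne_discriminant
  · intro h0
    have := congrArg (Polynomial.eval 2) h0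
    norm_num at this
  · have hgeo : (1 - PowerSeries.X) * (PowerSeries.mk 1 : ℂ⟦X⟧) = 1 := by
      rw [mul_comm]
      exact PowerSeries.mk_one_mul_one_sub_eq_one ℂ
    have h2 : ((2 : Polynomial ℂ) : ℂ⟦X⟧) = 2 := map_ofNat Polynomial.coeToPowerSeries.ringHom 2
    have h3 : ((3 : Polynomial ℂ) : ℂ⟦X⟧) = 3 := map_ofNat Polynomial.coeToPowerSeries.ringHom 3
    have hroot : (1 - PowerSeries.X) ^ 3 - 2 * PowerSeries.X ^ 2 * (1 - PowerSeries.X) +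
        2 * PowerSeries.X ^ 3 - PowerSeries.X * (1 - PowerSeries.X) * PP₂ =
        (1 - PowerSeries.X) * discriminantRoot := by
      linear_combination -(1 - PowerSeries.X) * X_mul_PP₂ - 2 * PowerSeries.X ^ 3 * hgeo
    simp only [Polynomial.coe_mul, Polynomial.coe_add, Polynomial.coe_sub, Polynomial.coe_pow,
      Polynomial.coe_one, Polynomial.coe_X, h2, h3]
    rw [hroot, mul_pow, discriminantRoot_sq]
    ring

/-! ### The dominant singularity -/

theorem hasSum_PP₂ {ρ : ℝ} (h0 : 0 < ρ) (h1 : ρ < 2 / 5) (hρ : 1 - 3 * ρ - ρ ^ 2 - ρ ^ 3 = 0)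
    {z : ℂ} (hz : ‖z‖ < ρ) (hz0 : z ≠ 0) :
    HasSum (fun n => PP₂.coeff n * z ^ n)
      (((1 - z) ^ 2 - 2 * z ^ 2 + 2 * z ^ 3 * (1 - z)⁻¹) / z +
        -regularFactor ρ z / z * (1 - z / ρ) ^ (1 / 2 : ℂ)) := by
  obtain ⟨K, hK, hD⟩ := exists_discriminantRoot_eq_mul h0 h1 hρ
  have hroot := (hK.mono (by linarith : ρ ≤ 1)).mul (hasSumOnBall_sqrtSeries h0)
  rw [← hD] at hroot
  have hp := HasSumOnBall.of_polynomial
    ((1 - Polynomial.X) ^ 2 - 2 * Polynomial.X ^ 2 : Polynomial ℂ) ρ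
  have hq := (HasSumOnBall.of_polynomial (2 * Polynomial.X ^ 3 : Polynomial ℂ) ρ).mul
    (HasSumOnBall.geometric.mono (by linarith : ρ ≤ 1))
  have h := (hp.add hq).sub hroot
  have h2 : ((2 : Polynomial ℂ) : ℂ⟦X⟧) = 2 := map_ofNat Polynomial.coeToPowerSeries.ringHom 2
  simp only [Polynomial.coe_mul, Polynomial.coe_sub, Polynomial.coe_pow,
    Polynomial.coe_one, Polynomial.coe_X, h2] at h
  rw [← X_mul_PP₂] at h
  convert h.div_X hz hz0 using 1
  simp
  ring

/-- Convergence inside the disc gives one inequality. For the other, a larger radius would make the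
terms at some $r>\rho$ tend to $0$, and the factor $n^{3/2}(\rho/r)^n\to0$ would then contradict the
positive limit. -/
theorem convergenceRadius_PP₂ {ρ A : ℝ} (h0 : 0 < ρ) (h1 : ρ < 2 / 5)
    (hρ : 1 - 3 * ρ - ρ ^ 2 - ρ ^ 3 = 0) (hA : 0 < A)
    (h : Tendsto (fun m : ℕ => (m : ℝ) ^ (3 / 2 : ℝ) * (pp₂ m * ρ ^ m)) atTop (𝓝 A)) :
    convergenceRadius PP₂ = ENNReal.ofReal ρ := by
  have hnorm (n : ℕ) : ‖FormalMultilinearSeries.ofScalars ℂ (fun n => PP₂.coeff n) n‖ =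
      (pp₂ n : ℝ) := by
    rw [FormalMultilinearSeries.ofScalars_norm]
    simp [PP₂]
  refine le_antisymm ?_ (ENNReal.le_of_forall_nnreal_lt fun r hr => ?_)
  · by_contra hlt
    obtain ⟨r, hr1, hr2⟩ := ENNReal.lt_iff_exists_nnreal_btwn.1 (not_le.1 hlt)
    have hr : ρ < r := by
      rwa [← ENNReal.ofReal_coe_nnreal, ENNReal.ofReal_lt_ofReal_iff_of_nonneg h0.le] at hr1
    have hr0 : (0 : ℝ) < r := h0.trans hr
    have hlim := ((isLittleO_one_iff ℝ).1
      (FormalMultilinearSeries.isLittleO_one_of_lt_radius _ hr2)).mul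
      (tendsto_rpow_mul_pow (div_pos h0 hr0) ((div_lt_one hr0).2 hr))
    rw [mul_zero] at hlim
    refine hA.ne (tendsto_nhds_unique (hlim.congr fun n => ?_) h)
    rw [hnorm, div_pow]
    field_simp
  · have hr' : (r : ℝ) < ρ := by
      rwa [← ENNReal.ofReal_coe_nnreal, ENNReal.ofReal_lt_ofReal_iff_of_nonneg r.coe_nonneg] at hr
    rcases eq_or_ne r 0 with rfl | hr0
    · simp
    · refine FormalMultilinearSeries.le_radius_of_summable _ ?_
      have hz : ‖((r : ℝ) : ℂ)‖ < ρ := by simpa using hr'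
      have := (hasSum_PP₂ h0 h1 hρ hz (by simpa using hr0)).summable.norm
      refine this.congr fun n => ?_
      rw [hnorm]
      simp [PP₂]

theorem hasDominantSqrtSingularity_PP₂ {ρ A : ℝ} (h0 : 0 < ρ) (h1 : ρ < 2 / 5)
    (hρ : 1 - 3 * ρ - ρ ^ 2 - ρ ^ 3 = 0) (hA : 0 < A)
    (h : Tendsto (fun m : ℕ => (m : ℝ) ^ (3 / 2 : ℝ) * (pp₂ m * ρ ^ m)) atTop (𝓝 A)) :
    HasDominantSqrtSingularity PP₂ ρ := by
  have hlt : ∀ {z : ℂ}, ‖z‖ = ρ → ‖z‖ < 1 := fun hz => by rw [hz]; linarith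
  have hne0 : ∀ {z : ℂ}, ‖z‖ = ρ → z ≠ 0 := fun hz => norm_pos_iff.1 (by rw [hz]; exact h0)
  have hg : ∀ {z : ℂ}, ‖z‖ = ρ → AnalyticAt ℂ
      (fun z => ((1 - z) ^ 2 - 2 * z ^ 2 + 2 * z ^ 3 * (1 - z)⁻¹) / z) z := by
    intro z hz
    have h1z : 1 - z ≠ 0 := sub_ne_zero.2 (by
      rintro rfl
      simpa using hlt hz)
    have hz0 := hne0 hz
    refine AnalyticAt.div ?_ analyticAt_id hz0
    exact ((by fun_prop : AnalyticAt ℂ (fun z : ℂ => (1 - z) ^ 2 - 2 * z ^ 2) z)).add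
      ((by fun_prop : AnalyticAt ℂ (fun z : ℂ => 2 * z ^ 3) z).mul
        ((by fun_prop : AnalyticAt ℂ (fun z : ℂ => 1 - z) z).inv h1z))
  have hh : ∀ {z : ℂ}, ‖z‖ = ρ → AnalyticAt ℂ (fun z => -regularFactor ρ z / z) z := fun hz =>
    (analyticAt_regularFactor h0 h1 (hlt hz)).neg.div analyticAt_id (hne0 hz)
  have hsum : ∀ {ζ : ℂ}, ‖ζ‖ = ρ → ∀ᶠ t in 𝓝[Metric.ball 0 ρ] ζ, analyticSum PP₂ t =
      ((1 - t) ^ 2 - 2 * t ^ 2 + 2 * t ^ 3 * (1 - t)⁻¹) / t +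
        -regularFactor ρ t / t * (1 - t / ρ) ^ (1 / 2 : ℂ) := by
    intro ζ hζ
    filter_upwards [self_mem_nhdsWithin,
      mem_nhdsWithin_of_mem_nhds (isOpen_ne.mem_nhds (hne0 hζ))] with t ht ht0
    exact (hasSum_PP₂ h0 h1 hρ (by simpa using ht) ht0).tsum_eq
  have hnρ : ‖(ρ : ℂ)‖ = ρ := by rw [Complex.norm_real, Real.norm_of_nonneg h0.le]
  refine ⟨h0, convergenceRadius_PP₂ h0 h1 hρ hA h, fun ζ hζ hne => ?_, ?_⟩
  · exact ⟨_, (hg hζ).add ((hh hζ).mul (analyticAt_sqrt_one_sub_div h0 hζ.le hne)), hsum hζ⟩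
  · refine ⟨_, _, hg hnρ, hh hnρ, ?_, hsum hnρ⟩
    refine div_ne_zero (neg_ne_zero.2 ?_) (hne0 hnρ)
    rw [regularFactor_self h0 h1, Complex.ofReal_ne_zero]
    have : 0 < 1 - ρ := by linarith
    positivity

end Prudent

namespace Prudent

/-! ### The explicit constants -/

theorem theta_pos : 0 < theta := by
  rw [theta]
  positivity

theorem theta_pow_three : theta ^ 3 = 26 + 6 * √33 := by
  rw [theta, ← Real.rpow_natCast, ← Real.rpow_mul (by positivity)]
  norm_num

theorem theta_pow_six : theta ^ 6 = 52 * theta ^ 3 + 512 := by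
  have h := theta_pow_three
  have h33 : √(33 : ℝ) ^ 2 = 33 := Real.sq_sqrt (by norm_num)
  rw [show theta ^ 6 = (theta ^ 3) ^ 2 by ring, h]
  linear_combination 36 * h33

/-- Cardano: $t=(s-1)/3$ turns the equation into $s^3+24s-52=0$, solved by $s=\theta-8/\theta$ when
$\theta^3-512/\theta^3=52$. -/
theorem cubic_eq_zero {ρ : ℝ} (h : ρ = (theta ^ 2 - theta - 8) / (3 * theta)) :
    1 - 3 * ρ - ρ ^ 2 - ρ ^ 3 = 0 := by
  have hθ := theta_pos.ne'
  have h6 := theta_pow_six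
  rw [h]
  field_simp
  linear_combination -h6

/-- The divided difference as a positive constant plus squares: the cubic is strictly decreasing,
which gives both uniqueness of the root and its numerical bounds. -/
theorem cubic_sub_cubic (t u : ℝ) :
    (1 - 3 * t - t ^ 2 - t ^ 3) - (1 - 3 * u - u ^ 2 - u ^ 3) =
      (u - t) * (((t + u) ^ 2 + (t + 1) ^ 2 + (u + 1) ^ 2 + 4) / 2) := by
  ring

theorem cubic_lt_iff {t u : ℝ} :
    1 - 3 * t - t ^ 2 - t ^ 3 < 1 - 3 * u - u ^ 2 - u ^ 3 ↔ u < t := by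
  have hp : 0 < ((t + u) ^ 2 + (t + 1) ^ 2 + (u + 1) ^ 2 + 4) / 2 := by positivity
  rw [← sub_neg, cubic_sub_cubic, ← sub_neg (a := u)]
  exact ⟨fun h => neg_of_mul_neg_left h hp.le, fun h => mul_neg_of_neg_of_pos h hp⟩

theorem cubic_eq_zero_iff {ρ : ℝ} (hρ : 1 - 3 * ρ - ρ ^ 2 - ρ ^ 3 = 0) (t : ℝ) :
    1 - 3 * t - t ^ 2 - t ^ 3 = 0 ↔ t = ρ := by
  refine ⟨fun h => ?_, fun h => h ▸ hρ⟩
  rcases lt_trichotomy t ρ with hlt | heq | hlt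
  · have := cubic_lt_iff.2 hlt
    linarith
  · exact heq
  · have := cubic_lt_iff.2 hlt
    linarith

theorem root_bounds {ρ : ℝ} (hρ : 1 - 3 * ρ - ρ ^ 2 - ρ ^ 3 = 0) :
    0.29559774252 < ρ ∧ ρ < 0.29559774253 := by
  constructor
  · rw [← cubic_lt_iff, hρ]
    norm_num
  · rw [← cubic_lt_iff, hρ]
    norm_num

/-- Writing $\sqrt{33}$ through $\theta^3$ leaves an identity in $\theta$ alone, true modulo
`theta_pow_six`. -/
theorem amplitude_radicand {ρ : ℝ} (h : ρ = (theta ^ 2 - theta - 8) / (3 * theta)) :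
    (-37 + 11 * √33) * theta ^ 2 + (-152 + 8 * √33) * theta + 32 =
      24 * ((1 - ρ) * (1 + ρ * (1 + ρ) * ρ + ρ * ρ ^ 2)) := by
  have hθ := theta_pos.ne'
  have h6 := theta_pow_six
  have hs : √33 = (theta ^ 3 - 26) / 6 := by
    rw [theta_pow_three]
    ring
  rw [h, hs]
  field_simp
  linear_combination (891 * theta ^ 3 + 936 * theta ^ 2 - 1584 * theta - 2304) * h6

theorem amplitude_eq {ρ : ℝ} (h0 : 0 < ρ)
    (h : ρ = (theta ^ 2 - theta - 8) / (3 * theta)) :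
    √((1 - ρ) * (1 + ρ * (1 + ρ) * ρ + ρ * ρ ^ 2)) / (2 * √Real.pi * ρ) =
      √((-37 + 11 * √33) * theta ^ 2 + (-152 + 8 * √33) * theta + 32) /
        (4 * √(6 * Real.pi) * ρ) := by
  have h24 : √(24 : ℝ) = 2 * √6 := by
    rw [show (24 : ℝ) = 2 ^ 2 * 6 by norm_num, Real.sqrt_mul (by norm_num),
      Real.sqrt_sq (by norm_num)]
  rw [amplitude_radicand h, Real.sqrt_mul (by norm_num : (0 : ℝ) ≤ 24),
    Real.sqrt_mul (by norm_num : (0 : ℝ) ≤ 6), h24]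
  have h6 : √(6 : ℝ) ≠ 0 := by positivity
  have hpi : √Real.pi ≠ 0 := by positivity
  field_simp
  norm_num

theorem amplitude_bounds {ρ : ℝ} (hρ : 1 - 3 * ρ - ρ ^ 2 - ρ ^ 3 = 0) :
    0.8548166 ≤ √((1 - ρ) * (1 + ρ * (1 + ρ) * ρ + ρ * ρ ^ 2)) / (2 * √Real.pi * ρ) ∧
      √((1 - ρ) * (1 + ρ * (1 + ρ) * ρ + ρ * ρ ^ 2)) / (2 * √Real.pi * ρ) < 0.8548167 := by
  obtain ⟨hl, hu⟩ := root_bounds hρ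
  have h0 : 0 < ρ := by linarith
  have hpl := Real.pi_gt_d20
  have hpu := Real.pi_lt_d20
  -- Reduction modulo the cubic to degree $2$, so that the squared bounds are linear in $\rho$,
  -- $\rho^2$ and $\pi\rho^2$.
  have hpoly : (1 - ρ) * (1 + ρ * (1 + ρ) * ρ + ρ * ρ ^ 2) = 4 - 12 * ρ + 4 * ρ ^ 2 := by
    linear_combination (2 * ρ - 3) * hρ
  have hden : 0 < 2 * √Real.pi * ρ := by positivity
  have hpi : √Real.pi ^ 2 = Real.pi := Real.sq_sqrt Real.pi_pos.le
  have hsl : 0.29559774252 ^ 2 < ρ ^ 2 := pow_lt_pow_left₀ hl (by norm_num) (by norm_num)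
  have hsu : ρ ^ 2 < 0.29559774253 ^ 2 := pow_lt_pow_left₀ hu h0.le (by norm_num)
  have hπ := Real.pi_pos
  constructor
  · rw [le_div_iff₀ hden]
    refine Real.le_sqrt_of_sq_le ?_
    rw [mul_pow, mul_pow, mul_pow, hpi]
    have hm : Real.pi * ρ ^ 2 ≤ 3.14159265358979323847 * 0.29559774253 ^ 2 :=
      mul_le_mul hpu.le hsu.le (by positivity) (by norm_num)
    rw [hpoly]
    norm_num at hm hsu hsl hl hu ⊢
    linarith
  · rw [div_lt_iff₀ hden, Real.sqrt_lt' (by positivity)]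
    rw [mul_pow, mul_pow, mul_pow, hpi]
    have hm : 3.14159265358979323846 * 0.29559774252 ^ 2 ≤ Real.pi * ρ ^ 2 :=
      mul_le_mul hpl.le hsl.le (by positivity) (by positivity)
    rw [hpoly]
    norm_num at hm hsu hsl hl hu ⊢
    linarith

end Prudent

theorem mainTheorem4 :
    ∃ ρ A : ℝ,
      -- the dominant singularity is the unique real root of the cubic, with its closed form
      (∀ t : ℝ, t ≠ 1 →
        (1 - 4 * t + 2 * t ^ 2 + t ^ 4) / (1 - t) = 1 - 3 * t - t ^ 2 - t ^ 3) ∧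
      (∀ t : ℝ, 1 - 3 * t - t ^ 2 - t ^ 3 = 0 ↔ t = ρ) ∧
      ρ = (Prudent.theta ^ 2 - Prudent.theta - 8) / (3 * Prudent.theta) ∧
      0.2955977 ≤ ρ ∧ ρ < 0.2955978 ∧
      -- the analytic structure of the generating function
      Prudent.IsAlgebraicOfDegree Prudent.PP₂ 2 ∧
      Prudent.HasDominantSqrtSingularity Prudent.PP₂ ρ ∧
      -- the asymptotic number of two-sided prudent polygons
      (fun m : ℕ => (Prudent.pp₂ m : ℝ)) ~[atTop]
        (fun m : ℕ => A * ρ ^ (-(m : ℝ)) * (m : ℝ) ^ (-(3 / 2) : ℝ)) ∧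
      A = √((-37 + 11 * √33) * Prudent.theta ^ 2 + (-152 + 8 * √33) * Prudent.theta + 32) /
        (4 * √(6 * Real.pi) * ρ) ∧
      0.8548166 ≤ A ∧ A < 0.8548167 := by
  set ρ : ℝ := (Prudent.theta ^ 2 - Prudent.theta - 8) / (3 * Prudent.theta) with h
  have hρ := Prudent.cubic_eq_zero h
  obtain ⟨hl, hu⟩ := Prudent.root_bounds hρ
  obtain ⟨hAl, hAu⟩ := Prudent.amplitude_bounds hρ
  have h0 : 0 < ρ := by linarith
  have h1 : ρ < 2 / 5 := by linarith
  have hlim := Prudent.tendsto_pp₂ h0 h1 hρ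
  rw [Prudent.amplitude_eq h0 h] at hAl hAu hlim
  have hA := lt_of_lt_of_le (by norm_num : (0 : ℝ) < 0.8548166) hAl
  refine ⟨ρ, _, fun t ht => ?_, Prudent.cubic_eq_zero_iff hρ, rfl, by linarith, by linarith,
    Prudent.isAlgebraicOfDegree_PP₂, Prudent.hasDominantSqrtSingularity_PP₂ h0 h1 hρ hA hlim,
    Prudent.pp₂_isEquivalent h0 hA.ne' hlim, rfl, hAl, hAu⟩
  rw [div_eq_iff (sub_ne_zero.2 ht.symm)]
  ring
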